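/- Work over $\mathbb{C}$. Let $d\ge 3$, and let $F\in\mathbb{C}[X,Y,Z]$ be an irreducible homogeneous polynomial of degree $d$ such that the curve $\{F=0\}\subset\mathbb{P}^2$ has exactly $n$ singular points, all of them nodes (ordinary double points), where $0\le n\le\binom{d-1}{2}-1$. Let $\Delta\subset\mathbb{P}^2$ be the reduced scheme of these nodes. Let $F_1,F_2,F_3$ be a general basis of the vector space $\langle F_X,F_Y,F_Z\rangle$ spanned by the partial derivatives of $F$; that is, these partials are linearly independent and there is a nonempty Zariski open subset $U\subset \mathrm{GL}_3(\mathbb{C})$, depending only on $F$, such that the assertions below hold for every basis $(F_1,F_2,F_3)^{T}=A\,(F_X,F_Y,F_Z)^{T}$ with $A\in U$. Denote also by $F_i$ the plane curve $\{F_i=0\}$. For a finite set of points $W\subset\mathbb{P}^2$, regarded as a reduced scheme, let $\ell(W)$ be its number of points and $h^0(\mathbb{P}^2,\mathcal{I}_W(k))$ the dimension of the space of homogeneous polynomials of degree $k$ that vanish on $W$. Then for all $i\neq j$ in $\{1,2,3\}$: (I) The scheme-theoretic intersection $F_i\cap F_j$ is the reduced scheme $\Delta\cup\Sigma_{ij}$,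 where $\Sigma_{ij}$ consists of $(d-1)^2-n$ distinct points and $\Sigma_{ij}\cap\Delta=\emptyset$. (II) There is a decomposition $\Sigma_{ij}=Z\cup Y$ with $Z\cap Y=\emptyset$, $\ell(Z)=\binom{d}{2}-n$, $\ell(Y)=\binom{d-1}{2}$ and $$h^0(\mathbb{P}^2,\mathcal{I}_{Z\cup\Delta}(d-2))=0=h^0(\mathbb{P}^2,\mathcal{I}_{Y}(d-3)).$$ -/

import Mathlib

open MvPolynomial
open scoped LinearAlgebra.Projectivization

namespace NodalPlaneCurve

/-- The homogeneous coordinate ring `ℂ[X, Y, Z]` of the complex projective plane. -/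
abbrev Poly : Type := MvPolynomial (Fin 3) ℂ

/-- The (closed) points of the complex projective plane. -/
abbrev P2 : Type := ℙ ℂ (Fin 3 → ℂ)

/-- The points of the plane at which the form `G` vanishes. For homogeneous `G` this does not
depend on the representatives. -/
def zeroSet (G : Poly) : Set P2 := {p | eval p.rep G = 0}

/-- The singular points of the curve `F = 0`: the points of the curve at which all the first
partial derivatives of `F` vanish. -/
def singularPoints (F : Poly) : Set P2 :=
  {p | eval p.rep F = 0 ∧ ∀ i, eval p.rep (pderiv i F) = 0}

/-- The matrix of second partial derivatives of `F` at `v`. -/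
noncomputable def hessian (F : Poly) (v : Fin 3 → ℂ) : Matrix (Fin 3) (Fin 3) ℂ :=
  Matrix.of fun i j => eval v (pderiv i (pderiv j F))

/-- `p` is a node (ordinary double point) of `F = 0`: a singular point at which the degree two part
of a local equation is a nondegenerate binary quadratic form, i.e. has two distinct linear factors
(the two tangent lines). At a singular point Euler's formula puts the line `p` into the kernel of
the `3 × 3` Hessian, and the quadratic form induced on `ℂ³ / p` is (up to a nonzero factor) the
degree two part of a local equation, so it is nondegenerate iff the Hessian has rank two. -/
def IsNode (F : Poly) (p : P2) : Prop :=
  p ∈ singularPoints F ∧ (hessian F p.rep).rank = 2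

/-- The nonzero vectors of `ℂ³` lying over a set of points of the plane. -/
def cone (S : Set P2) : Set (Fin 3 → ℂ) :=
  {v | ∃ hv : v ≠ 0, Projectivization.mk ℂ v hv ∈ S}

/-- The ideal of the reduced subscheme of the plane supported on the finite set `S`: the
polynomials vanishing at every representative of every point of `S`. -/
noncomputable def pointsIdeal (S : Set P2) : Ideal Poly := vanishingIdeal ℂ (cone S)

/-- Two homogeneous ideals define the same closed subscheme of the plane (equivalently, the same
ideal sheaf): they agree in all sufficiently large degrees. -/
def SameSubscheme (I J : Ideal Poly) : Prop :=
  ∃ N : ℕ, ∀ k, N ≤ k → ∀ H : Poly, H.IsHomogeneous k → (H ∈ I ↔ H ∈ J)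

/-- The scheme-theoretic intersection of the curves `G = 0` and `H = 0` is the reduced scheme
supported on the set of points `S`. -/
def InterEqReduced (G H : Poly) (S : Set P2) : Prop :=
  zeroSet G ∩ zeroSet H = S ∧ SameSubscheme (Ideal.span {G, H}) (pointsIdeal S)

/-- The space `H⁰(ℙ², I_S(k))` of forms of degree `k` vanishing on the reduced scheme `S`. -/
noncomputable def sectionsThrough (S : Set P2) (k : ℕ) : Submodule ℂ Poly :=
  homogeneousSubmodule (Fin 3) ℂ k ⊓ (pointsIdeal S).restrictScalars ℂ

/-- `h⁰(ℙ², I_S(k))`. -/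
noncomputable def h0 (S : Set P2) (k : ℕ) : Cardinal := Module.rank ℂ (sectionsThrough S k)

/-- The triple of linear combinations of the partials of `F` with coefficient matrix `A`. -/
noncomputable def combo (F : Poly) (A : Matrix (Fin 3) (Fin 3) ℂ) (i : Fin 3) : Poly :=
  ∑ j, A i j • pderiv j F

/-- `Q` holds for a general invertible matrix: it holds on the locus of `GL₃(ℂ)` where some nonzero
polynomial in the entries does not vanish. As such loci are a basis of the nonempty Zariski open
subsets of `GL₃(ℂ)`, this says that `Q` holds on a nonempty Zariski open subset. -/
def ForGeneralGL (Q : Matrix (Fin 3) (Fin 3) ℂ → Prop) : Prop :=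
  ∃ P : MvPolynomial (Fin 3 × Fin 3) ℂ, P ≠ 0 ∧
    ∀ A : Matrix (Fin 3) (Fin 3) ℂ, A.det ≠ 0 → eval (fun ij => A ij.1 ij.2) P ≠ 0 → Q A

end NodalPlaneCurve

/-! Write `q = A i × A j`. The two combinations meet at `v` exactly when the gradient of `F` at `v`
is a multiple of `q`, and their gradients there are the Hessian applied to `A i` and `A j`. They are
transversal if `q` is not a critical value of the gradient map and lies on none of the lines dual to
the nodes. Both conditions are generic (`exists_vanishing_on_critical_values`, `forGeneralGL_cross`,
`combo_transversal`). Max Noether's theorem and dimension counts then give part (I): forms vanishing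
on the intersection `Γ` lie in the ideal, and `Γ` has `(d-1)^2` points.

For (II), put `d = m + 3`. If no nonzero form of degree `m` vanishes on `Γ \ Δ`, choose `Y` in `Γ \
Δ` as a set of interpolation points for the forms of degree `m`, and let `Z` be the rest.
Cayley–Bacharach shows that a form of degree `m + 1` through `Z ∪ Δ` also passes through `Y`, so it
lies in an ideal generated in degree `m + 2` and is zero
(`Transversal.exists_linked_decomposition`).

It remains to see that a form `Q` of degree `m` vanishing on `Γ \ Δ` is zero. By Noether's theorem,
each product of `Q` with a partial lies in the ideal of the two combinations, which is a syzygy of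
degree `m` between the partials. Such a syzygy `δ` vanishes (`syzygy_eq_zero`): along the curve `δ ×
x` is proportional to the gradient, with ratio of degree `-1`. Multiplication by this ratio sends
forms vanishing at the nodes to forms vanishing at the nodes, one degree lower. If `δ × x` were
nonzero, descent on the degree would force every form through the nodes to be divisible by `F`,
which fails for the partials. -/

namespace NodalPlaneCurve

/-! ### Critical values of polynomial maps -/

/-- In characteristic zero a derivation of a domain that kills a subring kills every element
algebraic over it. -/
theorem derivation_eq_zero_of_isAlgebraic {A B : Type*} [CommRing A] [CommRing B] [Algebra A B]
    [IsDomain A] [IsDomain B] [CharZero A] [FaithfulSMul A B] (D : Derivation A B B) {x : B}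
    (hx : IsAlgebraic A x) : D x = 0 := by
  classical
  -- An annihilating polynomial of least degree has a derivative that does not vanish at `x`.
  have hex : ∃ m : ℕ, ∃ p : Polynomial A, p ≠ 0 ∧ Polynomial.aeval x p = 0 ∧ p.natDegree = m := by
    obtain ⟨p, hp, hpx⟩ := hx
    exact ⟨_, p, hp, hpx, rfl⟩
  obtain ⟨p, hp, hpx, hpm⟩ := Nat.find_spec hex
  have h1 := D.map_aeval p x
  rw [hpx, map_zero] at h1
  rcases smul_eq_zero.1 h1.symm with h2 | h2
  · exfalso
    have hdeg : 0 < p.natDegree := by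
      rw [Nat.pos_iff_ne_zero]
      intro h0
      rw [Polynomial.eq_C_of_natDegree_eq_zero h0, Polynomial.aeval_C] at hpx
      have := (FaithfulSMul.algebraMap_eq_zero_iff A B).1 hpx
      apply hp
      rw [Polynomial.eq_C_of_natDegree_eq_zero h0, this, Polynomial.C_0]
    have hne : Polynomial.derivative p ≠ 0 := by
      intro h0
      have := Polynomial.derivative_eq_zero.1 h0
      omega
    have hlt := Polynomial.natDegree_derivative_lt hdeg.ne'
    exact Nat.find_min hex (hpm ▸ hlt) ⟨_, hne, h2, rfl⟩
  · exact h2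

/-- Three ternary polynomials over which the polynomial ring is algebraic have nonzero Jacobian
determinant. -/
theorem jacobian_det_ne_zero (g : Fin 3 → Poly)
    (halg : Algebra.IsAlgebraic (Algebra.adjoin ℂ (Set.range g)) Poly) :
    (Matrix.of fun i j => pderiv j (g i)).det ≠ 0 := by
  intro h0
  -- A kernel vector of the Jacobian matrix is a vector field killing every `g i`. It is therefore a
  -- derivation over the subalgebra they generate, and must kill the coordinates.
  obtain ⟨c, hc, hc0⟩ := Matrix.exists_mulVec_eq_zero_iff.2 h0
  let D0 : Derivation ℂ Poly Poly := ∑ j, c j • pderiv j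
  have hD0 (f : Poly) : D0 f = ∑ j, c j * pderiv j f := by
    simp [D0, Fin.sum_univ_three]
  have hDg (i) : D0 (g i) = 0 := by
    rw [hD0]
    have := congrFun hc0 i
    simp only [Matrix.mulVec, dotProduct, Matrix.of_apply, Pi.zero_apply] at this
    rw [← this]
    exact Finset.sum_congr rfl fun _ _ => mul_comm _ _
  have hDA : ∀ a ∈ Algebra.adjoin ℂ (Set.range g), D0 a = 0 := by
    intro a ha
    induction ha using Algebra.adjoin_induction with
    | mem x hx => obtain ⟨i, rfl⟩ := hx; exact hDg i
    | algebraMap r => exact D0.map_algebraMap r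
    | add x y _ _ hx hy => rw [map_add, hx, hy, add_zero]
    | mul x y _ _ hx hy => rw [D0.leibniz, hx, hy, smul_zero, smul_zero, add_zero]
  let D : Derivation (Algebra.adjoin ℂ (Set.range g)) Poly Poly := Derivation.mk'
    { toFun := D0
      map_add' := D0.map_add
      map_smul' := fun a f => by
        rw [Algebra.smul_def, D0.leibniz, RingHom.id_apply]
        have : D0 (algebraMap _ Poly a) = 0 := hDA _ a.2
        rw [this, smul_zero, add_zero]
        rfl }
    (fun a b => D0.leibniz a b)
  apply hc
  funext j
  have h1 : D (X j) = 0 := derivation_eq_zero_of_isAlgebraic D (halg.1 _)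
  have h2 : D0 (X j) = 0 := h1
  rw [hD0] at h2
  simpa [pderiv_X, Pi.single_apply] using h2

/-- The critical values of a polynomial map `ℂ³ → ℂ³` lie in a proper algebraic subset. -/
theorem exists_vanishing_on_critical_values (g : Fin 3 → Poly) :
    ∃ Φ : Poly, Φ ≠ 0 ∧ ∀ v : Fin 3 → ℂ,
      (Matrix.of fun i j => eval v (pderiv j (g i))).det = 0 →
        eval (fun i => eval v (g i)) Φ = 0 := by
  have hev (v : Fin 3 → ℂ) (Φ : Poly) :
      eval (fun i => eval v (g i)) Φ = eval v (aeval g Φ) := by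
    induction Φ using MvPolynomial.induction_on with
    | C a => simp
    | add p q hp hq => simp only [map_add, hp, hq]
    | mul_X p i hp => simp only [map_mul, hp, eval_X, aeval_X]
  by_cases hg : AlgebraicIndependent ℂ g
  · have htb : IsTranscendenceBasis ℂ g := by
      apply hg.isTranscendenceBasis_of_trdeg_le_of_finite
      rw [MvPolynomial.trdeg_of_isDomain]
      simp
    have halg : Algebra.IsAlgebraic (Algebra.adjoin ℂ (Set.range g)) Poly := htb.isAlgebraic
    -- The Jacobian is algebraic over `ℂ[g]`, so it has a nonzero multiple in `ℂ[g]`; written as a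
    -- polynomial in `g`, that multiple is `Φ`.
    obtain ⟨a, ha, b, hb⟩ := (halg.1 (Matrix.of fun i j => pderiv j (g i)).det).exists_nonzero_dvd
      (mem_nonZeroDivisors_of_ne_zero (jacobian_det_ne_zero g halg))
    obtain ⟨Φ, hΦ⟩ : ∃ Φ : Poly, aeval g Φ = (a : Poly) := by
      have haA : (a : Poly) ∈ (aeval g : Poly →ₐ[ℂ] Poly).range :=
        Algebra.adjoin_range_eq_range_aeval ℂ g ▸ a.2
      exact haA
    refine ⟨Φ, ?_, fun v hv => ?_⟩
    · rintro rfl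
      apply ha
      apply Subtype.ext
      rw [← hΦ]
      simp
    · rw [hev]
      have h1 : aeval g Φ = (Matrix.of fun i j => pderiv j (g i)).det * b := by
        rw [← hb]; exact hΦ
      rw [h1, map_mul, RingHom.map_det]
      convert zero_mul _
      rw [← hv]
      congr 1
  -- In the dependent case an algebraic relation vanishes on the whole image.
  · rw [algebraicIndependent_iff] at hg
    push Not at hg
    obtain ⟨Φ, h1, h2⟩ := hg
    exact ⟨Φ, h2, fun v _ => by rw [hev, h1, map_zero]⟩

/-! ### Homogeneous components and divisibility -/

section Graded

attribute [local instance] MvPolynomial.gradedAlgebra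

theorem homogeneousComponent_add_mul {G : Poly} {m : ℕ} (hG : G.IsHomogeneous m) (k : ℕ)
    (B : Poly) : homogeneousComponent (m + k) (G * B) = G * homogeneousComponent k B := by
  have := DirectSum.coe_decompose_mul_add_of_left_mem (homogeneousSubmodule (Fin 3) ℂ)
    (i := m) (j := k) (b := B) ((mem_homogeneousSubmodule _ _).2 hG)
  rw [← decomposition.decompose'_apply, ← decomposition.decompose'_apply]
  exact this

theorem homogeneousComponent_mul_of_lt {G : Poly} {m n : ℕ} (hG : G.IsHomogeneous m) (h : n < m)
    (B : Poly) : homogeneousComponent n (G * B) = 0 := by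
  have := DirectSum.coe_decompose_mul_of_left_mem_of_not_le (homogeneousSubmodule (Fin 3) ℂ)
    (i := m) (n := n) (b := B) ((mem_homogeneousSubmodule _ _).2 hG) (by omega)
  rw [← decomposition.decompose'_apply]
  exact this

end Graded

theorem dvd_homogeneousComponent {F p : Poly} {m : ℕ} (hF : F.IsHomogeneous m) (h : F ∣ p)
    (n : ℕ) : F ∣ homogeneousComponent n p := by
  obtain ⟨B, rfl⟩ := h
  rcases lt_or_ge n m with hn | hn
  · rw [homogeneousComponent_mul_of_lt hF hn]
    exact dvd_zero _
  · obtain ⟨k, rfl⟩ := Nat.exists_eq_add_of_le hn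
    rw [homogeneousComponent_add_mul hF]
    exact dvd_mul_right _ _

theorem eq_zero_of_dvd_of_lt {F p : Poly} {m n : ℕ} (hF : F.IsHomogeneous m)
    (hp : p.IsHomogeneous n) (h : n < m) (hdvd : F ∣ p) : p = 0 := by
  obtain ⟨B, rfl⟩ := hdvd
  rw [← homogeneousComponent_eq_self hp, homogeneousComponent_mul_of_lt hF h]

theorem exists_homogeneous_of_dvd {F p : Poly} {m n : ℕ} (hF : F.IsHomogeneous m)
    (hp : p.IsHomogeneous (m + n)) (hdvd : F ∣ p) :
    ∃ B : Poly, B.IsHomogeneous n ∧ p = F * B := by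
  obtain ⟨B, rfl⟩ := hdvd
  exact ⟨_, homogeneousComponent_isHomogeneous n B, by
    rw [← homogeneousComponent_add_mul hF, homogeneousComponent_eq_self hp]⟩

theorem exists_homogeneous_of_mem_span_pair {G H f : Poly} {e m : ℕ} (hG : G.IsHomogeneous e)
    (hH : H.IsHomogeneous e) (hf : f.IsHomogeneous (e + m)) (hmem : f ∈ Ideal.span {G, H}) :
    ∃ a b : Poly, a.IsHomogeneous m ∧ b.IsHomogeneous m ∧ f = a * G + b * H := by
  obtain ⟨a, b, rfl⟩ := Ideal.mem_span_pair.1 hmem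
  refine ⟨_, _, homogeneousComponent_isHomogeneous m a, homogeneousComponent_isHomogeneous m b, ?_⟩
  rw [← homogeneousComponent_eq_self hf, map_add, mul_comm a, mul_comm b,
    homogeneousComponent_add_mul hG, homogeneousComponent_add_mul hH, mul_comm G, mul_comm H]

theorem eq_zero_of_mem_span_pair_of_lt {G H f : Poly} {e m : ℕ} (hG : G.IsHomogeneous e)
    (hH : H.IsHomogeneous e) (hf : f.IsHomogeneous m) (hm : m < e)
    (hmem : f ∈ Ideal.span {G, H}) : f = 0 := by
  obtain ⟨a, b, rfl⟩ := Ideal.mem_span_pair.1 hmem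
  rw [← homogeneousComponent_eq_self hf, map_add, mul_comm a, mul_comm b,
    homogeneousComponent_mul_of_lt hG hm, homogeneousComponent_mul_of_lt hH hm, add_zero]

theorem aeval_mul_of_isHomogeneous {Q : Poly} {k : ℕ} (hQ : Q.IsHomogeneous k) (v : Fin 3 → ℂ)
    (t : Poly) : aeval (fun l => C (v l) * t) Q = C (eval v Q) * t ^ k := by
  rw [aeval_def, eval₂_eq, eval_eq, map_sum, Finset.sum_mul]
  refine Finset.sum_congr rfl fun s hs => ?_
  rw [hQ.degree_eq_sum_deg_support hs]
  simp only [mul_pow, Finset.prod_mul_distrib, map_mul, map_prod, map_pow, algebraMap_eq]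
  rw [Finset.prod_pow_eq_pow_sum]
  ring

theorem eval_smul_of_isHomogeneous {Q : Poly} {k : ℕ} (hQ : Q.IsHomogeneous k) (v : Fin 3 → ℂ)
    (t : ℂ) : eval (t • v) Q = t ^ k * eval v Q := by
  rw [eval_eq, eval_eq, Finset.mul_sum]
  refine Finset.sum_congr rfl fun s hs => ?_
  rw [hQ.degree_eq_sum_deg_support hs]
  simp only [Pi.smul_apply, smul_eq_mul, mul_pow, Finset.prod_mul_distrib]
  rw [Finset.prod_pow_eq_pow_sum]
  ring

theorem sub_aeval_mem {I : Ideal Poly} {w : Fin 3 → Poly} (h : ∀ l, X l - w l ∈ I) (f : Poly) :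
    f - aeval w f ∈ I := by
  induction f using MvPolynomial.induction_on with
  | C a => simp
  | add p q hp hq =>
    rw [map_add, add_sub_add_comm]
    exact I.add_mem hp hq
  | mul_X p i hp =>
    have : p * X i - aeval w (p * X i) = p * (X i - w i) + (p - aeval w p) * w i := by
      rw [map_mul, aeval_X]; ring
    rw [this]
    exact I.add_mem (I.mul_mem_left _ (h i)) (I.mul_mem_right _ hp)

/-! ### Elimination of a variable and ideals of points -/

/-- The substitution of `p` for the variable `i`. -/
noncomputable def elimVar (i : Fin 3) (p : Poly) : Poly →ₐ[ℂ] Poly := aeval (Function.update X i p)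

theorem dvd_sub_elimVar (i : Fin 3) (p f : Poly) : X i - p ∣ f - elimVar i p f := by
  rw [← Ideal.mem_span_singleton]
  apply sub_aeval_mem
  intro l
  rcases eq_or_ne l i with rfl | hl
  · simp
  · simp [Function.update_of_ne hl]

theorem elimVar_idem {i : Fin 3} {p : Poly} (hp : elimVar i p p = p) (f : Poly) :
    elimVar i p (elimVar i p f) = elimVar i p f := by
  have : (elimVar i p).comp (elimVar i p) = elimVar i p := by
    apply algHom_ext
    intro l
    rcases eq_or_ne l i with rfl | hl
    · simpa [elimVar] using hp
    · simp [elimVar, Function.update_of_ne hl]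
  exact DFunLike.congr_fun this f

theorem elimVar_sub {i : Fin 3} {p : Poly} (hp : elimVar i p p = p) :
    elimVar i p (X i - p) = 0 := by
  rw [map_sub, hp]; simp [elimVar]

theorem dvd_of_elimVar_eq_zero {i : Fin 3} {p f : Poly} (h : elimVar i p f = 0) : X i - p ∣ f := by
  simpa [h] using dvd_sub_elimVar i p f

/-- The multiples of `X i - p` are the kernel of `elimVar i p`, a ring map into a domain. -/
theorem prime_X_sub {i : Fin 3} {p : Poly} (hp : elimVar i p p = p) (hne : X i - p ≠ 0) :
    Prime (X i - p) := by
  have hdvd (f : Poly) : X i - p ∣ f ↔ elimVar i p f = 0 :=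
    ⟨fun ⟨g, hg⟩ => by rw [hg, map_mul, elimVar_sub hp, zero_mul], dvd_of_elimVar_eq_zero⟩
  refine ⟨hne, fun hu => ?_, fun f g => ?_⟩
  · have h1 := (hdvd 1).1 hu.dvd
    rw [map_one] at h1
    exact one_ne_zero h1
  · simp only [hdvd, map_mul, mul_eq_zero, imp_self]

/-- Two linear forms generating the homogeneous ideal of a point of the plane. -/
theorem exists_linear_forms {v : Fin 3 → ℂ} (hv : v ≠ 0) :
    ∃ u₁ u₂ : Poly, u₁.IsHomogeneous 1 ∧ u₂.IsHomogeneous 1 ∧ eval v u₁ = 0 ∧ eval v u₂ = 0 ∧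
      IsRelPrime u₁ u₂ ∧ u₁ ≠ 0 ∧
      ∀ (k : ℕ) (Q : Poly), Q.IsHomogeneous k → eval v Q = 0 → Q ∈ Ideal.span {u₁, u₂} := by
  obtain ⟨k, hk⟩ := Function.ne_iff.1 hv
  have hk' : v k ≠ 0 := hk
  obtain ⟨i, j, hij, hik, hjk, huniv⟩ :
      ∃ i j : Fin 3, i ≠ j ∧ i ≠ k ∧ j ≠ k ∧ ∀ l, l = i ∨ l = j ∨ l = k := by
    clear * -; revert k; decide
  have hlin (i : Fin 3) : (X i - C (v i) * (C (v k)⁻¹ * X k) : Poly).IsHomogeneous 1 := by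
    rw [← mul_assoc, ← C_mul]
    exact (isHomogeneous_X ℂ i).sub (isHomogeneous_C_mul_X _ k)
  have hev (i : Fin 3) : eval v (X i - C (v i) * (C (v k)⁻¹ * X k)) = 0 := by
    simp [hk']
  have hne (i : Fin 3) (hik : i ≠ k) : X i - C (v i) * (C (v k)⁻¹ * X k) ≠ 0 := by
    intro h0
    have := congrArg (eval (Pi.single i 1)) h0
    simp [hik.symm] at this
  refine ⟨X i - C (v i) * (C (v k)⁻¹ * X k), X j - C (v j) * (C (v k)⁻¹ * X k), hlin i, hlin j,
    hev i, hev j, ?_, ?_, fun m Q hQ hQv => ?_⟩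
  · rw [(prime_X_sub ?_ (hne i hik)).irreducible.isRelPrime_iff_not_dvd]
    · rintro ⟨g, hg⟩
      apply hne j hjk
      have h3 := congrArg (elimVar i (C (v i) * (C (v k)⁻¹ * X k))) hg
      rw [map_mul, elimVar_sub (by simp [elimVar, hik.symm]), zero_mul] at h3
      simpa [elimVar, hik.symm, hij.symm] using h3
    · simp [elimVar, hik.symm]
  · exact hne i hik
  -- Modulo the two linear forms the coordinate vector is `(X k / v k) • v`, so `Q` becomes `Q(v)`
  -- times a power of `X k / v k`.
  · have h := sub_aeval_mem (I := Ideal.span {X i - C (v i) * (C (v k)⁻¹ * X k),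
      X j - C (v j) * (C (v k)⁻¹ * X k)}) (w := fun l => C (v l) * (C (v k)⁻¹ * X k)) ?_ Q
    · rwa [aeval_mul_of_isHomogeneous hQ, hQv, C_0, zero_mul, sub_zero] at h
    · intro l
      rcases huniv l with rfl | rfl | rfl
      · exact Ideal.subset_span (by simp)
      · exact Ideal.subset_span (by simp)
      · have : (X l - C (v l) * (C (v l)⁻¹ * X l) : Poly) = 0 := by
          rw [← mul_assoc, ← C_mul, mul_inv_cancel₀ hk', C_1, one_mul, sub_self]
        rw [this]
        exact Ideal.zero_mem _

/-- Where two forms meet transversally, they generate the ideal of the point locally. -/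
theorem exists_local_multiplier {G H Q : Poly} {e e' k : ℕ} (hG : G.IsHomogeneous e)
    (hH : H.IsHomogeneous e') (hQ : Q.IsHomogeneous k) {v : Fin 3 → ℂ} (hv : v ≠ 0)
    (hGv : eval v G = 0) (hHv : eval v H = 0) (hQv : eval v Q = 0)
    (hind : LinearIndependent ℂ
      ![fun l => eval v (pderiv l G), fun l => eval v (pderiv l H)]) :
    ∃ r : Poly, eval v r ≠ 0 ∧ r * Q ∈ Ideal.span {G, H} := by
  obtain ⟨u₁, u₂, -, -, h1, h2, -, -, hspan⟩ := exists_linear_forms hv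
  obtain ⟨a, b, rfl⟩ := Ideal.mem_span_pair.1 (hspan _ G hG hGv)
  obtain ⟨a', b', rfl⟩ := Ideal.mem_span_pair.1 (hspan _ H hH hHv)
  obtain ⟨s, t, rfl⟩ := Ideal.mem_span_pair.1 (hspan _ Q hQ hQv)
  -- By Cramer's rule the determinant of the coefficients of `G`, `H` in terms of `u₁`, `u₂` carries
  -- both linear forms into the ideal. Independence of the gradients makes it nonzero at `v`.
  refine ⟨a * b' - b * a', fun h0 => ?_, ?_⟩
  · rw [LinearIndependent.pair_iff] at hind
    simp only [map_sub, map_mul] at h0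
    have hd (a b : Poly) (l : Fin 3) : eval v (pderiv l (a * u₁ + b * u₂)) =
        eval v a * eval v (pderiv l u₁) + eval v b * eval v (pderiv l u₂) := by
      simp [h1, h2]
    have key (s t : ℂ) (h1 : s * eval v a + t * eval v a' = 0)
        (h2 : s * eval v b + t * eval v b' = 0) : s = 0 ∧ t = 0 := by
      apply hind
      funext l
      simp only [Pi.add_apply, Pi.smul_apply, smul_eq_mul, hd, Pi.zero_apply]
      linear_combination eval v (pderiv l u₁) * h1 + eval v (pderiv l u₂) * h2
    have hb := key (eval v b') (-eval v b) (by linear_combination h0) (by ring)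
    have ha := key (eval v a') (-eval v a) (by ring) (by linear_combination -h0)
    have := key 1 0 (by linear_combination -ha.2) (by linear_combination -hb.2)
    exact one_ne_zero this.1
  · refine Ideal.mem_span_pair.2 ⟨s * b' - t * a', t * a - s * b, by ring⟩

/-- If `Ga + Hb = 0` with `G`, `H` relatively prime then `(a, b)` is a multiple of `(H, -G)`. -/
theorem exists_koszul {G H a b : Poly} (hrel : IsRelPrime G H) (h : a * G + b * H = 0) :
    ∃ c, a = c * H ∧ b = -(c * G) := by
  have h1 : H ∣ a * G := ⟨-b, by linear_combination h⟩
  obtain ⟨c, hc⟩ := hrel.symm.dvd_of_dvd_mul_right h1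
  rcases eq_or_ne H 0 with rfl | hH
  · have hu : IsUnit G := hrel dvd_rfl (dvd_zero _)
    obtain ⟨g, hg⟩ := hu.exists_right_inv
    rw [zero_mul] at hc
    exact ⟨-(b * g), by rw [hc]; ring, by linear_combination (-b) * hg⟩
  · refine ⟨c, by rw [hc]; ring, mul_right_cancel₀ hH ?_⟩
    rw [hc] at h
    linear_combination h

/-! ### Max Noether's theorem -/

/-- This is the Nullstellensatz for ideals with no zero off the origin. -/
theorem exists_pow_mem_of_zeroLocus {I : Ideal Poly} (hI : ∀ v, v ∈ zeroLocus ℂ I → v = 0)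
    {f : Poly} (hf : eval 0 f = 0) : ∃ N, f ^ N ∈ I := by
  have : f ∈ I.radical := by
    rw [← vanishingIdeal_zeroLocus_eq_radical (K := ℂ), mem_vanishingIdeal_iff]
    intro v hv
    rw [hI v hv]
    simpa using hf
  exact this

/-- If the line `xᵢ = p` misses the intersection of `G` and `H`, then its equation is a
nonzerodivisor modulo `(G, H)`. -/
theorem mem_span_pair_of_linear_mul_mem {G H f p : Poly} {i : Fin 3} (hp : elimVar i p p = p)
    (hne : X i - p ≠ 0)
    (hzero : ∀ v, eval v G = 0 → eval v H = 0 → v i = eval v p → v = 0)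
    (hmem : (X i - p) * f ∈ Ideal.span {G, H}) : f ∈ Ideal.span {G, H} := by
  obtain ⟨a, b, hab⟩ := Ideal.mem_span_pair.1 hmem
  set φ := elimVar i p with hφ
  -- A common factor of the restrictions to the line divides powers of both remaining variables,
  -- since the restrictions have no common zero but the origin.
  have hrel : IsRelPrime (φ G) (φ H) := by
    intro D hG hH
    have hX (j : Fin 3) (hj : j ≠ i) : ∃ N, D ∣ (X j : Poly) ^ N := by
      have hI : ∀ v, v ∈ zeroLocus ℂ (Ideal.span {G, H, X i - p}) → v = 0 := by
        intro v hv
        rw [zeroLocus_span] at hv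
        have h1 := hv G (by simp)
        have h2 := hv H (by simp)
        have h3 := hv (X i - p) (by simp)
        simp only [aeval_eq_eval] at h1 h2 h3
        exact hzero v h1 h2 (by simpa [sub_eq_zero] using h3)
      obtain ⟨N, hN⟩ := exists_pow_mem_of_zeroLocus hI (f := X j) (by simp)
      refine ⟨N, ?_⟩
      obtain ⟨s, z, hz, h1⟩ := Ideal.mem_span_insert.1 hN
      obtain ⟨t, z', hz', h2⟩ := Ideal.mem_span_insert.1 hz
      obtain ⟨q, h3⟩ := Ideal.mem_span_singleton.1 hz'
      have h4 := congrArg φ h1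
      rw [h2, h3] at h4
      simp only [map_add, map_mul, elimVar_sub hp, hφ, map_pow] at h4
      have : elimVar i p (X j) = X j := by simp [elimVar, Function.update_of_ne hj]
      rw [this] at h4
      rw [h4, zero_mul, add_zero]
      exact dvd_add (hG.mul_left _) (hH.mul_left _)
    obtain ⟨j, l, hjl, hj, hl⟩ : ∃ j l : Fin 3, j ≠ l ∧ j ≠ i ∧ l ≠ i := by
      clear * -; revert i; decide
    obtain ⟨N, hN⟩ := hX j hj
    obtain ⟨N', hN'⟩ := hX l hl
    have hjl' : IsRelPrime (X j : Poly) (X l) := by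
      rw [X_prime.irreducible.isRelPrime_iff_not_dvd, X_dvd_X]
      exact hjl
    exact (hjl'.pow) hN hN'
  have h0 : φ a * φ G + φ b * φ H = 0 := by
    rw [← map_mul, ← map_mul, ← map_add, hab, map_mul, elimVar_sub hp, zero_mul]
  -- On the line the relation is a Koszul relation. Subtracting its lift `c (H, -G)` makes both
  -- coefficients divisible by `X i - p`.
  obtain ⟨c, hca, hcb⟩ := exists_koszul hrel h0
  obtain ⟨a', ha'⟩ : X i - p ∣ a - c * H := dvd_of_elimVar_eq_zero (by
    rw [map_sub, map_mul, ← hφ, ← elimVar_idem hp a, ← hφ, hca, map_mul, elimVar_idem hp H, sub_self])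
  obtain ⟨b', hb'⟩ : X i - p ∣ b + c * G := dvd_of_elimVar_eq_zero (by
    rw [map_add, map_mul, ← hφ, ← elimVar_idem hp b, ← hφ, hcb, map_neg, map_mul,
      elimVar_idem hp G, neg_add_cancel])
  refine Ideal.mem_span_pair.2 ⟨a', b', ?_⟩
  apply mul_left_cancel₀ hne
  linear_combination hab - G * ha' - H * hb'

/-- Max Noether's theorem: membership in the ideal of a complete intersection is local. -/
theorem mem_span_pair_of_local {G H f p : Poly} {i : Fin 3} (hp : elimVar i p p = p)
    (hne : X i - p ≠ 0) (hp0 : eval 0 p = 0)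
    (hzero : ∀ v, eval v G = 0 → eval v H = 0 → v i = eval v p → v = 0)
    (hloc : ∀ v, v ≠ 0 → eval v G = 0 → eval v H = 0 →
      ∃ r, eval v r ≠ 0 ∧ r * f ∈ Ideal.span {G, H}) : f ∈ Ideal.span {G, H} := by
  -- The conductor of `f` into `(G, H)` has no zero off the origin, so it contains a power of `X i -
  -- p`, whose factors are then cancelled one at a time.
  have hI : ∀ v, v ∈ zeroLocus ℂ ((Ideal.span {G, H}).colon {f}) → v = 0 := by
    intro v hv
    by_contra hv0
    have hz (r : Poly) (hr : r * f ∈ Ideal.span {G, H}) : eval v r = 0 := by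
      have := hv r (by rw [Submodule.mem_colon_singleton]; exact hr)
      simpa [aeval_eq_eval] using this
    obtain ⟨r, hr, hr'⟩ := hloc v hv0
      (hz G (Ideal.mul_mem_right _ _ (Ideal.subset_span (by simp))))
      (hz H (Ideal.mul_mem_right _ _ (Ideal.subset_span (by simp))))
    exact hr (hz r hr')
  obtain ⟨N, hN⟩ := exists_pow_mem_of_zeroLocus hI (f := X i - p) (by rw [map_sub, hp0]; simp)
  rw [Submodule.mem_colon_singleton, smul_eq_mul] at hN
  induction N with
  | zero => simpa using hN
  | succ N ih =>
    apply ih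
    apply mem_span_pair_of_linear_mul_mem hp hne hzero
    rw [← mul_assoc, ← pow_succ']
    exact hN

theorem exists_eval_ne_zero {σ : Type*} {P : MvPolynomial σ ℂ} (hP : P ≠ 0) :
    ∃ v, eval v P ≠ 0 := by
  by_contra! h
  exact hP (MvPolynomial.funext fun v => by rw [h v, map_zero])

theorem eval_rep_mk_eq_zero_iff {G : Poly} {e : ℕ} (hG : G.IsHomogeneous e) {v : Fin 3 → ℂ}
    (hv : v ≠ 0) : eval (Projectivization.mk ℂ v hv).rep G = 0 ↔ eval v G = 0 := by
  obtain ⟨a, ha⟩ := Projectivization.exists_smul_eq_mk_rep ℂ v hv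
  rw [← ha, Units.smul_def, eval_smul_of_isHomogeneous hG]
  simp

/-- The curves `G = 0` and `H = 0` intersect transversally. -/
def Transversal (G H : Poly) : Prop :=
  ∀ v : Fin 3 → ℂ, v ≠ 0 → eval v G = 0 → eval v H = 0 →
    LinearIndependent ℂ ![fun l => eval v (pderiv l G), fun l => eval v (pderiv l H)]

/-- Otherwise `D` would divide powers of both `X 0` and `X 1`. -/
theorem exists_ne_zero_eval_eq_zero {D : Poly} (hD : ¬ IsUnit D) :
    ∃ v : Fin 3 → ℂ, v ≠ 0 ∧ eval v D = 0 := by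
  by_contra! h
  have hI : ∀ v, v ∈ zeroLocus ℂ (Ideal.span {D}) → v = 0 := by
    intro v hv
    rw [zeroLocus_span] at hv
    by_contra hv0
    exact h v hv0 (by simpa [aeval_eq_eval] using hv D (by simp))
  obtain ⟨N, hN⟩ := exists_pow_mem_of_zeroLocus hI (f := X 0) (by simp)
  obtain ⟨N', hN'⟩ := exists_pow_mem_of_zeroLocus hI (f := X 1) (by simp)
  rw [Ideal.mem_span_singleton] at hN hN'
  have hrel : IsRelPrime (X 0 : Poly) (X 1) := by
    rw [X_prime.irreducible.isRelPrime_iff_not_dvd, X_dvd_X]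
    decide
  exact hD (hrel.pow hN hN')

/-- At a zero of a common factor `D` both gradients are multiples of the gradient of `D`. -/
theorem Transversal.isRelPrime {G H : Poly} (h : Transversal G H) : IsRelPrime G H := by
  rintro D ⟨G, rfl⟩ ⟨H, rfl⟩
  by_contra hD
  obtain ⟨v, hv, hDv⟩ := exists_ne_zero_eval_eq_zero hD
  have hind := h v hv (by rw [map_mul, hDv, zero_mul]) (by rw [map_mul, hDv, zero_mul])
  rw [LinearIndependent.pair_iff] at hind
  have h1 := hind (eval v H) (-eval v G) (by
    funext l
    simp [hDv]
    ring)
  have h2 := hind 1 0 (by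
    funext l
    simp [hDv, neg_eq_zero.1 h1.2])
  exact one_ne_zero h2.1

/-! ### Dimension of the graded pieces of `(G, H)` -/

section Dimension

theorem finrank_homogeneousSubmodule (k : ℕ) :
    Module.finrank ℂ (homogeneousSubmodule (Fin 3) ℂ k) = (k + 2).choose 2 := by
  have hs : {d : Fin 3 →₀ ℕ | d.degree = k} =
      ((Finset.univ.finsuppAntidiag k : Finset (Fin 3 →₀ ℕ)) : Set (Fin 3 →₀ ℕ)) := by
    ext d
    simp [Finsupp.degree_eq_sum]
  rw [homogeneousSubmodule_eq_finsupp_supported, hs,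
    (AddMonoidAlgebra.supportedEquivFinsupp (R := ℂ) (S := ℂ) _).finrank_eq, Module.finrank_finsupp_self,
    ← Nat.card_eq_fintype_card, Nat.card_coe_set_eq, Set.ncard_coe_finset,
    Finset.card_finsuppAntidiag_nat_eq_choose]
  rw [Finset.card_univ, Fintype.card_fin, Nat.choose_symm_of_eq_add (a := k) (b := 2) (by omega)]
  congr 1
  omega

instance (k : ℕ) : FiniteDimensional ℂ (homogeneousSubmodule (Fin 3) ℂ k) :=
  Module.finite_of_finrank_pos (by
    rw [finrank_homogeneousSubmodule]
    exact Nat.choose_pos (by omega))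

/-- The multiples of the form `G` by forms of degree `m`. -/
noncomputable def multiples (G : Poly) (m : ℕ) : Submodule ℂ Poly :=
  (homogeneousSubmodule (Fin 3) ℂ m).map (LinearMap.mulLeft ℂ G)

instance (G : Poly) (m : ℕ) : FiniteDimensional ℂ (multiples G m) := by
  unfold multiples; infer_instance

theorem mem_multiples {G f : Poly} {m : ℕ} :
    f ∈ multiples G m ↔ ∃ a : Poly, a.IsHomogeneous m ∧ G * a = f := by
  simp [multiples]

theorem finrank_multiples {G : Poly} (hG : G ≠ 0) (m : ℕ) :
    Module.finrank ℂ (multiples G m) = (m + 2).choose 2 := by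
  rw [← finrank_homogeneousSubmodule]
  exact (Submodule.equivMapOfInjective (LinearMap.mulLeft ℂ G)
    (mul_right_injective₀ hG) _).finrank_eq.symm

theorem multiples_inf {G H : Poly} {e : ℕ} (hG : G.IsHomogeneous e) (hH : H.IsHomogeneous e)
    (hrel : IsRelPrime G H) (m : ℕ) :
    multiples G (e + m) ⊓ multiples H (e + m) = multiples (G * H) m := by
  ext f
  simp only [Submodule.mem_inf, mem_multiples]
  constructor
  · rintro ⟨⟨a, ha, rfl⟩, b, hb, hab⟩
    have h1 : H ∣ a := hrel.symm.dvd_of_dvd_mul_left ⟨b, hab.symm⟩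
    obtain ⟨c, hc, rfl⟩ := exists_homogeneous_of_dvd hH ha h1
    exact ⟨c, hc, by ring⟩
  · rintro ⟨c, hc, rfl⟩
    exact ⟨⟨H * c, hH.mul hc, by ring⟩, G * c, hG.mul hc, by ring⟩

/-- The overlap of the two spaces of multiples consists of the multiples of `G * H`. The count shows
that `(G, H)` has codimension `e ^ 2` in every degree from `2 * e` on. -/
theorem finrank_multiples_sup {G H : Poly} {e : ℕ} (hG : G.IsHomogeneous e)
    (hH : H.IsHomogeneous e) (hG0 : G ≠ 0) (hH0 : H ≠ 0) (hrel : IsRelPrime G H) (m : ℕ) :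
    Module.finrank ℂ ↥(multiples G (e + m) ⊔ multiples H (e + m)) + e ^ 2 =
      (2 * e + m + 2).choose 2 := by
  have h := Submodule.finrank_sup_add_finrank_inf_eq (multiples G (e + m)) (multiples H (e + m))
  rw [multiples_inf hG hH hrel, finrank_multiples hG0, finrank_multiples hH0,
    finrank_multiples (mul_ne_zero hG0 hH0)] at h
  have hc (n : ℕ) : (n + 2) * (n + 1) = 2 * (n + 2).choose 2 := by
    have := Nat.add_one_mul_choose_eq (n + 1) 1
    simp at this
    linarith
  have h1 := hc (e + m)
  have h2 := hc m
  have h3 := hc (2 * e + m)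
  nlinarith

end Dimension

/-! ### Conditions imposed by points -/

section Evaluation

/-- Evaluation at (the representatives of) a finite set of points. -/
noncomputable def evalAt (T : Finset P2) : Poly →ₗ[ℂ] (T → ℂ) :=
  LinearMap.pi fun p => (aeval (R := ℂ) p.1.rep).toLinearMap

@[simp]
theorem evalAt_apply (T : Finset P2) (f : Poly) (p : T) : evalAt T f p = eval p.1.rep f := by
  simp [evalAt, aeval_eq_eval]

theorem exists_linear_form_separating {p q : P2} (hpq : p ≠ q) :
    ∃ u : Poly, u.IsHomogeneous 1 ∧ eval p.rep u ≠ 0 ∧ eval q.rep u = 0 := by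
  by_contra! h
  apply hpq
  obtain ⟨k, hk⟩ := Function.ne_iff.1 q.rep_nonzero
  have hk' : q.rep k ≠ 0 := hk
  rw [← p.mk_rep, ← q.mk_rep, Projectivization.mk_eq_mk_iff']
  refine ⟨p.rep k / q.rep k, ?_⟩
  funext i
  by_contra hne
  have := h (C (q.rep k) * X i - C (q.rep i) * X k)
    ((isHomogeneous_C_mul_X _ i).sub (isHomogeneous_C_mul_X _ k)) ?_
  · apply this
    simp
    ring
  · intro h0
    apply hne
    simp only [map_sub, map_mul, eval_C, eval_X] at h0
    rw [Pi.smul_apply, smul_eq_mul]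
    field_simp
    linear_combination -h0

theorem exists_form_separating (T : Finset P2) (p : P2) (hp : p ∉ T) {k : ℕ} (hk : T.card ≤ k) :
    ∃ h : Poly, h.IsHomogeneous k ∧ eval p.rep h ≠ 0 ∧ ∀ q ∈ T, eval q.rep h = 0 := by
  have hu (q : P2) (hq : q ∈ T) := exists_linear_form_separating (p := p) (q := q)
    (fun h => hp (h ▸ hq))
  choose! u hu1 hu2 hu3 using hu
  obtain ⟨i, hi⟩ := Function.ne_iff.1 p.rep_nonzero
  refine ⟨(∏ q ∈ T, u q) * X i ^ (k - T.card), ?_, ?_, fun q hq => ?_⟩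
  · have := (IsHomogeneous.prod T u (fun _ => 1) hu1).mul
      (isHomogeneous_X_pow (R := ℂ) i (k - T.card))
    simpa [Nat.add_sub_cancel' hk] using this
  · rw [map_mul, map_prod, map_pow, eval_X]
    exact mul_ne_zero (Finset.prod_ne_zero_iff.2 hu2) (pow_ne_zero _ hi)
  · rw [map_mul, map_prod, Finset.prod_eq_zero hq (hu3 q hq), zero_mul]

theorem evalAt_surjective (T : Finset P2) {k : ℕ} (hk : T.card ≤ k) :
    Function.Surjective ((evalAt T).domRestrict (homogeneousSubmodule (Fin 3) ℂ k)) := by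
  classical
  rw [← LinearMap.range_eq_top, eq_top_iff, ← (Pi.basisFun ℂ T).span_eq, Submodule.span_le]
  rintro _ ⟨p, rfl⟩
  obtain ⟨h, hh, hp, hq⟩ := exists_form_separating (T.erase p) p (Finset.notMem_erase _ _) (k := k)
    ((Finset.card_erase_le).trans hk)
  refine ⟨(eval p.1.rep h)⁻¹ • ⟨h, hh⟩, ?_⟩
  funext q
  rw [map_smul, Pi.smul_apply, LinearMap.domRestrict_apply, evalAt_apply, smul_eq_mul,
    Pi.basisFun_apply, Pi.single_apply]
  split_ifs with hqp
  · rw [hqp, inv_mul_cancel₀ hp]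
  · rw [hq q.1 (Finset.mem_erase.2 ⟨fun h => hqp (Subtype.ext h), q.2⟩), mul_zero]

/-- The forms of degree `k` vanishing at (the representatives of) the points of `T`. -/
noncomputable def formsVanishingAt (T : Finset P2) (k : ℕ) : Submodule ℂ Poly :=
  homogeneousSubmodule (Fin 3) ℂ k ⊓ (evalAt T).ker

theorem mem_formsVanishingAt {T : Finset P2} {k : ℕ} {f : Poly} :
    f ∈ formsVanishingAt T k ↔ f.IsHomogeneous k ∧ ∀ p ∈ T, eval p.rep f = 0 := by
  simp [formsVanishingAt, funext_iff]

instance (T : Finset P2) (k : ℕ) : FiniteDimensional ℂ (formsVanishingAt T k) :=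
  Submodule.finiteDimensional_inf_left _ _

theorem finrank_range_add_finrank_formsVanishingAt (T : Finset P2) (k : ℕ) :
    Module.finrank ℂ ((evalAt T).domRestrict (homogeneousSubmodule (Fin 3) ℂ k)).range +
      Module.finrank ℂ (formsVanishingAt T k) =
        (k + 2).choose 2 := by
  rw [← finrank_homogeneousSubmodule, ← LinearMap.finrank_range_add_finrank_ker
    ((evalAt T).domRestrict (homogeneousSubmodule (Fin 3) ℂ k))]
  congr 1
  have hker : ((evalAt T).domRestrict (homogeneousSubmodule (Fin 3) ℂ k)).ker =
      (formsVanishingAt T k).comap (homogeneousSubmodule (Fin 3) ℂ k).subtype := by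
    ext f
    simp [formsVanishingAt]
  rw [hker]
  exact (Submodule.comapSubtypeEquivOfLe inf_le_left).finrank_eq.symm

end Evaluation

/-! ### Bézout and Cayley–Bacharach for transversal curves -/

theorem multiples_le {G : Poly} {e m : ℕ} (hG : G.IsHomogeneous e)
    (T : Finset P2) (hT : ∀ p ∈ T, eval p.rep G = 0) :
    multiples G (e + m) ≤ formsVanishingAt T (2 * e + m) := by
  intro f hf
  obtain ⟨a, ha, rfl⟩ := mem_multiples.1 hf
  refine mem_formsVanishingAt.2 ⟨?_, fun p hp => by rw [map_mul, hT p hp, zero_mul]⟩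
  have h : 2 * e + m = e + (e + m) := by ring
  rw [h]
  exact hG.mul ha

/-- In degree `2 * e + T.card` the points of `T` impose independent conditions, while the forms
through `T` contain the piece of `(G, H)`, of codimension `e ^ 2`. -/
theorem card_le_sq {G H : Poly} {e : ℕ} (hG : G.IsHomogeneous e) (hH : H.IsHomogeneous e)
    (hG0 : G ≠ 0) (hH0 : H ≠ 0) (hrel : IsRelPrime G H)
    (T : Finset P2) (hT : ∀ p ∈ T, eval p.rep G = 0 ∧ eval p.rep H = 0) : T.card ≤ e ^ 2 := by
  have h1 := finrank_range_add_finrank_formsVanishingAt T (2 * e + T.card)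
  rw [LinearMap.range_eq_top.2 (evalAt_surjective T (by omega)), finrank_top,
    Module.finrank_fintype_fun_eq_card, Fintype.card_coe,
    ← finrank_multiples_sup hG hH hG0 hH0 hrel] at h1
  have h2 := Submodule.finrank_mono (sup_le
    (multiples_le (m := T.card) hG T fun p hp => (hT p hp).1)
    (multiples_le (m := T.card) hH T fun p hp => (hT p hp).2))
  omega

/-- In degree `2 * e` the forms through `T` lie in a space of codimension `e ^ 2`, and their own
codimension is at most `T.card`. -/
theorem sq_le_card {G H : Poly} {e : ℕ} (hG : G.IsHomogeneous e) (hH : H.IsHomogeneous e)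
    (hG0 : G ≠ 0) (hH0 : H ≠ 0) (hrel : IsRelPrime G H)
    (T : Finset P2) (hT : ∀ (k : ℕ) (f : Poly), f.IsHomogeneous k →
      (∀ p ∈ T, eval p.rep f = 0) → f ∈ Ideal.span {G, H}) : e ^ 2 ≤ T.card := by
  have h1 := finrank_range_add_finrank_formsVanishingAt T (2 * e + 0)
  rw [← finrank_multiples_sup hG hH hG0 hH0 hrel 0] at h1
  have h2 : formsVanishingAt T (2 * e + 0) ≤
      multiples G (e + 0) ⊔ multiples H (e + 0) := by
    intro f hfT
    obtain ⟨hf, hfT⟩ := mem_formsVanishingAt.1 hfT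
    have hf' : f.IsHomogeneous (e + (e + 0)) := by
      convert hf using 1
      ring
    obtain ⟨a, b, ha, hb, rfl⟩ := exists_homogeneous_of_mem_span_pair hG hH hf' (hT _ f hf'
      hfT)
    exact Submodule.add_mem_sup (mem_multiples.2 ⟨a, ha, mul_comm _ _⟩)
      (mem_multiples.2 ⟨b, hb, mul_comm _ _⟩)
  have h3 := Submodule.finrank_mono h2
  have h4 := Submodule.finrank_le ((evalAt T).domRestrict
    (homogeneousSubmodule (Fin 3) ℂ (2 * e + 0))).range
  rw [Module.finrank_fintype_fun_eq_card, Fintype.card_coe] at h4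
  omega

theorem finite_zeroSet_inter {G H : Poly} {e : ℕ} (hG : G.IsHomogeneous e)
    (hH : H.IsHomogeneous e) (hG0 : G ≠ 0) (hH0 : H ≠ 0) (hrel : IsRelPrime G H) :
    (zeroSet G ∩ zeroSet H).Finite := by
  by_contra hinf
  obtain ⟨T, hT, hTc⟩ := Set.Infinite.exists_subset_card_eq hinf (e ^ 2 + 1)
  have := card_le_sq hG hH hG0 hH0 hrel T fun p hp => hT hp
  omega

/-- A line `x₂ = α x₀ + β x₁` avoiding a finite set of points. -/
theorem exists_line_avoiding {S : Set P2} (hS : S.Finite) :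
    ∃ α β : ℂ, ∀ v ∈ cone S, v 2 ≠ α * v 0 + β * v 1 := by
  -- The variables `X 0` and `X 1` stand for the unknown coefficients `α` and `β`; each factor is
  -- the condition at one point.
  have hne : (∏ p ∈ hS.toFinset, (C (p.rep 2) - (C (p.rep 0) * X 0 + C (p.rep 1) * X 1)) : Poly)
      ≠ 0 := by
    rw [Finset.prod_ne_zero_iff]
    intro p _ h0
    apply p.rep_nonzero
    have e0 := congrArg (eval 0) h0
    have e1 := congrArg (eval ![1, 0, 0]) h0
    have e2 := congrArg (eval ![0, 1, 0]) h0
    simp at e0 e1 e2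
    rw [e0] at e1 e2
    funext i
    fin_cases i
    · simpa using e1
    · simpa using e2
    · exact e0
  obtain ⟨w, hw⟩ := exists_eval_ne_zero hne
  refine ⟨w 0, w 1, ?_⟩
  rintro v ⟨hv, hvS⟩ h
  rw [map_prod, Finset.prod_ne_zero_iff] at hw
  apply hw _ (hS.mem_toFinset.2 hvS)
  obtain ⟨a, ha⟩ := Projectivization.exists_smul_eq_mk_rep ℂ v hv
  rw [← ha]
  simp [Units.smul_def, h]
  ring

/-- A form vanishing on the intersection of two transversal curves of the same degree lies in the
ideal generated by their equations. -/
theorem Transversal.mem_span_pair {G H f : Poly} {e k : ℕ} (h : Transversal G H)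
    (hG : G.IsHomogeneous e) (hH : H.IsHomogeneous e) (hG0 : G ≠ 0) (hH0 : H ≠ 0)
    (hf : f.IsHomogeneous k) (hfv : ∀ p ∈ zeroSet G ∩ zeroSet H, eval p.rep f = 0) :
    f ∈ Ideal.span {G, H} := by
  obtain ⟨α, β, hαβ⟩ := exists_line_avoiding (finite_zeroSet_inter hG hH hG0 hH0 h.isRelPrime)
  have hmk (v : Fin 3 → ℂ) (hv : v ≠ 0) (h1 : eval v G = 0) (h2 : eval v H = 0) :
      Projectivization.mk ℂ v hv ∈ zeroSet G ∩ zeroSet H :=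
    ⟨(eval_rep_mk_eq_zero_iff hG hv).2 h1, (eval_rep_mk_eq_zero_iff hH hv).2 h2⟩
  refine mem_span_pair_of_local (i := 2) (p := C α * X 0 + C β * X 1) (by simp [elimVar]) ?_
    (by simp) (fun v h1 h2 h3 => ?_) (fun v hv h1 h2 => ?_)
  · intro h0
    simpa using congrArg (eval ![0, 0, 1]) h0
  · by_contra hv
    exact hαβ v ⟨hv, hmk v hv h1 h2⟩ (by simpa using h3)
  · exact exists_local_multiplier hG hH hf hv h1 h2
      ((eval_rep_mk_eq_zero_iff hf hv).1 (hfv _ (hmk v hv h1 h2))) (h v hv h1 h2)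

theorem Transversal.encard_inter {G H : Poly} {e : ℕ} (h : Transversal G H)
    (hG : G.IsHomogeneous e) (hH : H.IsHomogeneous e) (hG0 : G ≠ 0) (hH0 : H ≠ 0) :
    (zeroSet G ∩ zeroSet H).encard = (e ^ 2 : ℕ) := by
  have hfin := finite_zeroSet_inter hG hH hG0 hH0 h.isRelPrime
  rw [hfin.encard_eq_coe_toFinset_card, Nat.cast_inj]
  apply le_antisymm
  · exact card_le_sq hG hH hG0 hH0 h.isRelPrime _ fun p hp => (hfin.mem_toFinset.1 hp)
  · exact sq_le_card hG hH hG0 hH0 h.isRelPrime _ fun k f hf hfv =>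
      h.mem_span_pair hG hH hG0 hH0 hf fun p hp => hfv p (hfin.mem_toFinset.2 hp)

/-- The Cayley–Bacharach theorem for two transversal curves of degree `e`. -/
theorem Transversal.cayley_bacharach {G H f : Poly} {e : ℕ} (h : Transversal G H)
    (hG : G.IsHomogeneous (e + 2)) (hH : H.IsHomogeneous (e + 2)) (hG0 : G ≠ 0) (hH0 : H ≠ 0)
    (hf : f.IsHomogeneous (2 * e + 1)) {p : P2} (hp : p ∈ zeroSet G ∩ zeroSet H)
    (hfv : ∀ q ∈ zeroSet G ∩ zeroSet H, q ≠ p → eval q.rep f = 0) : eval p.rep f = 0 := by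
  obtain ⟨u₁, u₂, hu₁, hu₂, h1, h2, hrel, hu₁0, -⟩ := exists_linear_forms p.rep_nonzero
  have hmem (u : Poly) (hu : u.IsHomogeneous 1) (hup : eval p.rep u = 0) :
      ∃ a b : Poly, a.IsHomogeneous e ∧ b.IsHomogeneous e ∧ u * f = a * G + b * H := by
    have hd : (u * f).IsHomogeneous (e + 2 + e) := by
      convert hu.mul hf using 1
      ring
    apply exists_homogeneous_of_mem_span_pair hG hH hd
    apply h.mem_span_pair hG hH hG0 hH0 hd
    intro q hq
    rw [map_mul]
    rcases eq_or_ne q p with rfl | hqp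
    · rw [hup, zero_mul]
    · rw [hfv q hq hqp, mul_zero]
  obtain ⟨a, b, ha, hb, hab⟩ := hmem u₁ hu₁ h1
  obtain ⟨a', b', ha', hb', hab'⟩ := hmem u₂ hu₂ h2
  -- Eliminating `f` gives a relation between `G` and `H` with coefficients of degree `e + 1`, too
  -- small for a nontrivial Koszul relation. Hence `u₁` divides `a` and `b`, and can be cancelled.
  have hb0 : u₂ * b - u₁ * b' = 0 := by
    refine eq_zero_of_dvd_of_lt hG ((hu₂.mul hb).sub (hu₁.mul hb')) (by omega) ?_
    apply h.isRelPrime.dvd_of_dvd_mul_left (z := u₂ * b - u₁ * b') (y := H)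
    exact ⟨u₁ * a' - u₂ * a, by linear_combination u₁ * hab' - u₂ * hab⟩
  have ha0 : u₂ * a - u₁ * a' = 0 := by
    apply mul_right_cancel₀ hG0
    linear_combination u₁ * hab' - u₂ * hab - H * hb0
  obtain ⟨a'', rfl⟩ : u₁ ∣ a := hrel.dvd_of_dvd_mul_left ⟨a', sub_eq_zero.1 ha0⟩
  obtain ⟨b'', rfl⟩ : u₁ ∣ b := hrel.dvd_of_dvd_mul_left ⟨b', sub_eq_zero.1 hb0⟩
  have : f = a'' * G + b'' * H := by
    apply mul_left_cancel₀ hu₁0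
    rw [hab]; ring
  rw [this, map_add, map_mul, map_mul, show eval p.rep G = 0 from hp.1,
    show eval p.rep H = 0 from hp.2]
  ring

/-! ### Syzygies between the partials -/

theorem euler_identity {F : Poly} {d : ℕ} (hF : F.IsHomogeneous d) :
    X 0 * pderiv 0 F + X 1 * pderiv 1 F + X 2 * pderiv 2 F = (d : Poly) * F := by
  have := hF.sum_X_mul_pderiv
  rwa [Fin.sum_univ_three, nsmul_eq_mul] at this

theorem eval_eq_zero_of_partials {F : Poly} {d : ℕ} (hF : F.IsHomogeneous d) (hd : d ≠ 0)
    {v : Fin 3 → ℂ} (hv : ∀ i, eval v (pderiv i F) = 0) : eval v F = 0 := by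
  have h := congrArg (eval v) (euler_identity hF)
  simp only [map_add, map_mul, hv, mul_zero, add_zero, map_natCast] at h
  exact (mul_eq_zero.1 h.symm).resolve_left (Nat.cast_ne_zero.2 hd)

/-- The cross product of a vector of forms with the vector of coordinates. -/
noncomputable def crossX (δ : Fin 3 → Poly) : Fin 3 → Poly :=
  ![δ 1 * X 2 - δ 2 * X 1, δ 2 * X 0 - δ 0 * X 2, δ 0 * X 1 - δ 1 * X 0]

theorem crossX_isHomogeneous {δ : Fin 3 → Poly} {m : ℕ} (hδ : ∀ i, (δ i).IsHomogeneous m)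
    (j : Fin 3) : (crossX δ j).IsHomogeneous (m + 1) := by
  have h (i j : Fin 3) : (δ i * X j).IsHomogeneous (m + 1) := (hδ i).mul (isHomogeneous_X ℂ j)
  fin_cases j
  · exact (h 1 2).sub (h 2 1)
  · exact (h 2 0).sub (h 0 2)
  · exact (h 0 1).sub (h 1 0)

section Syzygy

variable {F : Poly} {d : ℕ} {δ : Fin 3 → Poly}

/-- This is `(δ × x) × ∇F = (δ · ∇F) x - (x · ∇F) δ`, combined with the syzygy and Euler's formula.
-/
theorem cross_partials (hF : F.IsHomogeneous d) (hδ : ∑ i, δ i * pderiv i F = 0) :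
    crossX δ 0 * pderiv 1 F - crossX δ 1 * pderiv 0 F = -(d : Poly) * δ 2 * F ∧
    crossX δ 1 * pderiv 2 F - crossX δ 2 * pderiv 1 F = -(d : Poly) * δ 0 * F ∧
    crossX δ 2 * pderiv 0 F - crossX δ 0 * pderiv 2 F = -(d : Poly) * δ 1 * F := by
  rw [Fin.sum_univ_three] at hδ
  have hE := euler_identity hF
  simp only [crossX, Matrix.cons_val_zero, Matrix.cons_val_one, Matrix.cons_val]
  refine ⟨?_, ?_, ?_⟩
  · linear_combination X 2 * hδ - δ 2 * hE
  · linear_combination X 0 * hδ - δ 0 * hE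
  · linear_combination X 1 * hδ - δ 1 * hE

theorem dvd_cross_partials (hF : F.IsHomogeneous d) (hδ : ∑ i, δ i * pderiv i F = 0)
    (i j : Fin 3) : F ∣ crossX δ i * pderiv j F - crossX δ j * pderiv i F := by
  obtain ⟨h2, h0, h1⟩ := cross_partials hF hδ
  have hself (i : Fin 3) : F ∣ crossX δ i * pderiv i F - crossX δ i * pderiv i F := by simp
  have hswap (i j : Fin 3) (h : F ∣ crossX δ i * pderiv j F - crossX δ j * pderiv i F) :
      F ∣ crossX δ j * pderiv i F - crossX δ i * pderiv j F := (dvd_sub_comm).1 h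
  have h01 : F ∣ crossX δ 0 * pderiv 1 F - crossX δ 1 * pderiv 0 F := ⟨_, h2.trans (mul_comm _ _)⟩
  have h12 : F ∣ crossX δ 1 * pderiv 2 F - crossX δ 2 * pderiv 1 F := ⟨_, h0.trans (mul_comm _ _)⟩
  have h20 : F ∣ crossX δ 2 * pderiv 0 F - crossX δ 0 * pderiv 2 F := ⟨_, h1.trans (mul_comm _ _)⟩
  fin_cases i <;> fin_cases j
  exacts [hself 0, h01, hswap _ _ h20, hswap _ _ h01, hself 1, h12, h20, hswap _ _ h12, hself 2]

/-- Differentiating the syzygy at a singular point puts `δ(v)` into the kernel of the Hessian, so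
`δ(v)` is parallel to `v`. -/
theorem eval_crossX_eq_zero (hδ : ∑ i, δ i * pderiv i F = 0) {v : Fin 3 → ℂ}
    (hv : ∀ i, eval v (pderiv i F) = 0)
    (hker : ∀ w, (hessian F v).mulVec w = 0 → ∃ c : ℂ, w = c • v) (j : Fin 3) :
    eval v (crossX δ j) = 0 := by
  obtain ⟨c, hc⟩ := hker (fun i => eval v (δ i)) (by
    funext l
    have h := congrArg (fun f => eval v (pderiv l f)) hδ
    simp only [map_sum, Derivation.leibniz, smul_eq_mul, map_add, map_mul, hv, zero_mul,
      add_zero, map_zero] at h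
    simp only [Matrix.mulVec, dotProduct, hessian, Matrix.of_apply, Pi.zero_apply]
    rw [← h]
    exact Finset.sum_congr rfl fun i _ => mul_comm _ _)
  have hc' (i : Fin 3) : eval v (δ i) = c * v i := congrFun hc i
  fin_cases j <;> simp [crossX, hc'] <;> ring

/-- On an irreducible curve the ratio of `δ × x` and the gradient carries forms vanishing at the
singular points to forms, provided the partials generate the ideals of these points locally. -/
theorem exists_quotient_form (hF : F.IsHomogeneous d) (hd : 2 ≤ d) (hirr : Irreducible F)
    (hδ : ∑ i, δ i * pderiv i F = 0) {Q : Poly}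
    (hloc : ∀ v, v ≠ 0 → (∀ i, eval v (pderiv i F) = 0) →
      ∃ r, eval v r ≠ 0 ∧ r * Q ∈ Ideal.span (Set.range fun i => pderiv i F)) :
    ∃ B : Poly, ∀ j, F ∣ pderiv j F * B - Q * crossX δ j := by
  have hprime : Prime F := hirr.prime
  obtain ⟨j₀, hj₀⟩ : ∃ j, ¬ F ∣ pderiv j F := by
    by_contra! h
    have h0 (j) : pderiv j F = 0 :=
      eq_zero_of_dvd_of_lt hF (hF.pderiv (i := j)) (by omega) (h j)
    apply hirr.ne_zero
    have hE := euler_identity hF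
    rw [h0, h0, h0] at hE
    simp only [mul_zero, add_zero] at hE
    exact (mul_eq_zero.1 hE.symm).resolve_left (Nat.cast_ne_zero.2 (by omega))
  -- The lines `u` and `u'` below meet only in `q`, which is off the curve.
  obtain ⟨q, hq⟩ := exists_eval_ne_zero (mul_ne_zero hirr.ne_zero (X_ne_zero (R := ℂ) (0 : Fin 3)))
  rw [map_mul, eval_X] at hq
  have hq0 := right_ne_zero_of_mul hq
  have hFq := left_ne_zero_of_mul hq
  have hI : ∀ v, v ∈ zeroLocus ℂ
      ((Ideal.span (Set.range fun i => pderiv i F)).colon {Q}) → v = 0 := by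
    intro v hv
    by_contra hv0
    have hz (r : Poly) (hr : r * Q ∈ Ideal.span (Set.range fun i => pderiv i F)) :
        eval v r = 0 := by
      have := hv r (by rw [Submodule.mem_colon_singleton]; exact hr)
      simpa [aeval_eq_eval] using this
    obtain ⟨r, hr, hr'⟩ := hloc v hv0 fun i =>
      hz _ (Ideal.mul_mem_right _ _ (Ideal.subset_span ⟨i, rfl⟩))
    exact hr (hz r hr')
  -- If `u ^ N * Q = ∑ c i * pderiv i F`, then `P = ∑ c i * crossX δ i` is a numerator of the
  -- desired quotient with denominator `u ^ N`.
  have hpow (u : Poly) (hu : eval 0 u = 0) : ∃ (N : ℕ) (P : Poly),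
      ∀ j, F ∣ pderiv j F * P - u ^ N * Q * crossX δ j := by
    obtain ⟨N, hN⟩ := exists_pow_mem_of_zeroLocus hI hu
    rw [Submodule.mem_colon_singleton, smul_eq_mul, Ideal.mem_span_range_iff_exists_fun] at hN
    obtain ⟨c, hc⟩ := hN
    refine ⟨N, ∑ i, c i * crossX δ i, fun j => ?_⟩
    rw [← hc, Finset.mul_sum, Finset.sum_mul, ← Finset.sum_sub_distrib]
    refine Finset.dvd_sum fun i _ => ?_
    have : pderiv j F * (c i * crossX δ i) - c i * pderiv i F * crossX δ j =
      c i * (crossX δ i * pderiv j F - crossX δ j * pderiv i F) := by ring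
    rw [this]
    exact (dvd_cross_partials hF hδ i j).mul_left _
  obtain ⟨N, P, hP⟩ := hpow (X 1 - C (q 1 / q 0) * X 0) (by simp)
  obtain ⟨N', P', hP'⟩ := hpow (X 2 - C (q 2 / q 0) * X 0) (by simp)
  set u : Poly := X 1 - C (q 1 / q 0) * X 0 with hu
  set u' : Poly := X 2 - C (q 2 / q 0) * X 0 with hu'
  -- The fractions with denominators `u ^ N` and `u' ^ N'` agree on the curve.
  have h1 : F ∣ u' ^ N' * P - u ^ N * P' := by
    refine (hprime.dvd_or_dvd ?_).resolve_left hj₀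
    have := ((hP j₀).mul_left (u' ^ N')).sub ((hP' j₀).mul_left (u ^ N))
    convert this using 1
    ring
  -- Since `u'` is a nonzerodivisor modulo `(F, u ^ N)`, the denominator `u ^ N` divides `P` on the
  -- curve.
  have h2 : ∀ n, u' ^ n * P ∈ Ideal.span {F, u ^ N} → P ∈ Ideal.span {F, u ^ N} := by
    intro n
    induction n with
    | zero => simp
    | succ n ih =>
      intro h
      apply ih
      refine mem_span_pair_of_linear_mul_mem (i := 2) (p := C (q 2 / q 0) * X 0)
        (by simp [elimVar]) ?_ ?_ (by rwa [← mul_assoc, ← pow_succ'])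
      · intro h0
        simpa using congrArg (eval ![0, 0, 1]) h0
      · intro v hFv huv hv2
        rw [map_pow] at huv
        have hv1 := eq_zero_of_pow_eq_zero huv
        simp only [hu, map_sub, map_mul, eval_X, eval_C] at hv1 hv2
        have hvq : v = (v 0 / q 0) • q := by
          funext i
          fin_cases i
          · simp [hq0]
          · simp; linear_combination hv1
          · simp; linear_combination hv2
        rw [hvq, eval_smul_of_isHomogeneous hF] at hFv
        have := eq_zero_of_pow_eq_zero ((mul_eq_zero.1 hFv).resolve_right hFq)
        rw [hvq, this, zero_smul]
  obtain ⟨c, hc⟩ := h1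
  obtain ⟨a, B, hB⟩ := Ideal.mem_span_pair.1 (h2 N' (Ideal.mem_span_pair.2
    ⟨c, P', by linear_combination -hc⟩))
  refine ⟨B, fun j => ?_⟩
  have hFu : ¬ F ∣ u := by
    intro h
    have hu1 : u.IsHomogeneous 1 := (isHomogeneous_X ℂ _).sub (isHomogeneous_C_mul_X _ _)
    have h0 := eq_zero_of_dvd_of_lt hF hu1 (by omega) h
    simpa [hu] using congrArg (eval ![0, 1, 0]) h0
  refine (hprime.dvd_or_dvd (a := u ^ N) ?_).resolve_left fun h => hFu (hprime.dvd_of_dvd_pow h)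
  have := (hP j).sub (dvd_mul_right F (pderiv j F * a))
  convert this using 1
  linear_combination pderiv j F * hB

/-- The partials of the equation of an irreducible nodal curve of degree `m + 3` have no nonzero
syzygies of degree `m`. -/
theorem syzygy_eq_zero {m : ℕ} (hF : F.IsHomogeneous (m + 3)) (hirr : Irreducible F)
    (hker : ∀ v, v ≠ 0 → (∀ i, eval v (pderiv i F) = 0) →
      ∀ w, (hessian F v).mulVec w = 0 → ∃ c : ℂ, w = c • v)
    (hne : ∀ v, v ≠ 0 → (∀ i, eval v (pderiv i F) = 0) → hessian F v ≠ 0)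
    (hloc : ∀ v, v ≠ 0 → (∀ i, eval v (pderiv i F) = 0) →
      ∀ (k : ℕ) (Q : Poly), Q.IsHomogeneous k → eval v Q = 0 →
        ∃ r, eval v r ≠ 0 ∧ r * Q ∈ Ideal.span (Set.range fun i => pderiv i F))
    (hδm : ∀ i, (δ i).IsHomogeneous m) (hδ : ∑ i, δ i * pderiv i F = 0) : δ = 0 := by
  have hprime : Prime F := hirr.prime
  have hpd (j : Fin 3) : (pderiv j F).IsHomogeneous (m + 2) := hF.pderiv
  suffices hM : ∀ j, crossX δ j = 0 by
    obtain ⟨h2, h0, h1⟩ := cross_partials hF hδ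
    simp only [hM, zero_mul, sub_zero] at h0 h1 h2
    have hd : (-((m + 3 : ℕ) : Poly)) ≠ 0 := neg_ne_zero.2 (Nat.cast_ne_zero.2 (by omega))
    have hz (p : Poly) (h : 0 = -((m + 3 : ℕ) : Poly) * p * F) : p = 0 :=
      (mul_eq_zero.1 ((mul_eq_zero.1 h.symm).resolve_right hirr.ne_zero)).resolve_left hd
    funext i
    fin_cases i
    exacts [hz _ h0, hz _ h1, hz _ h2]
  intro j
  by_contra hMj
  have hMj' : ¬ F ∣ crossX δ j := fun h =>
    hMj (eq_zero_of_dvd_of_lt hF (crossX_isHomogeneous hδm j) (by omega) h)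
  -- Descent on the degree: the quotient form `B` attached to `Q` has degree one less and again
  -- vanishes at the singular points.
  have key : ∀ (k : ℕ) (Q : Poly), Q.IsHomogeneous k →
      (∀ v, v ≠ 0 → (∀ i, eval v (pderiv i F) = 0) → eval v Q = 0) → F ∣ Q := by
    intro k
    induction k with
    | zero =>
      intro Q hQ hQv
      obtain ⟨B, hB⟩ := exists_quotient_form hF (by omega) hirr hδ
        (fun v hv h => hloc v hv h _ Q hQ (hQv v hv h))
      -- For constant `Q` the quotient would have degree `-1`: in degree `m + 1` the product of `B`
      -- with a partial has no component.
      refine (hprime.dvd_or_dvd ?_).resolve_right hMj'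
      have h := dvd_homogeneousComponent hF (hB j) (0 + (m + 1))
      rwa [map_sub, homogeneousComponent_eq_self (hQ.mul (crossX_isHomogeneous hδm j)),
        homogeneousComponent_mul_of_lt (hpd j) (by omega), zero_sub, dvd_neg] at h
    | succ k ih =>
      intro Q hQ hQv
      obtain ⟨B, hB⟩ := exists_quotient_form hF (by omega) hirr hδ
        (fun v hv h => hloc v hv h _ Q hQ (hQv v hv h))
      have hB' (j : Fin 3) :
          F ∣ pderiv j F * homogeneousComponent k B - Q * crossX δ j := by
        have hd : (Q * crossX δ j).IsHomogeneous (m + 2 + k) := by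
          convert hQ.mul (crossX_isHomogeneous hδm j) using 1
          ring
        have h := dvd_homogeneousComponent hF (hB j) (m + 2 + k)
        rwa [map_sub, homogeneousComponent_eq_self hd, homogeneousComponent_add_mul (hpd j)] at h
      have hFB : F ∣ homogeneousComponent k B := by
        refine ih _ (homogeneousComponent_isHomogeneous k B) fun v hv h => ?_
        by_contra hBv
        apply hne v hv h
        -- Differentiating the congruence modulo `F` at `v`, where `Q`, `crossX δ` and the gradient
        -- vanish, leaves `B(v)` times the Hessian equal to zero.
        ext l i
        obtain ⟨c, hc⟩ := hB' i
        have h1 := congrArg (fun f => eval v (pderiv l f)) hc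
        simp only [map_sub, Derivation.leibniz, smul_eq_mul, map_add, map_mul, h,
          hQv v hv h, eval_crossX_eq_zero hδ h (hker v hv h), zero_mul, mul_zero, add_zero,
          zero_add, sub_zero, eval_eq_zero_of_partials hF (by omega) h] at h1
        exact (mul_eq_zero.1 h1).resolve_left hBv
      refine (hprime.dvd_or_dvd ?_).resolve_right hMj'
      have := (hFB.mul_left (pderiv j F)).sub (hB' j)
      rwa [sub_sub_cancel] at this
  have h0 (i : Fin 3) : pderiv i F = 0 :=
    eq_zero_of_dvd_of_lt hF (hpd i) (by omega) (key _ _ (hpd i) fun v _ h => h i)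
  apply hirr.ne_zero
  have hE := euler_identity hF
  rw [h0, h0, h0] at hE
  simp only [mul_zero, add_zero] at hE
  exact (mul_eq_zero.1 hE.symm).resolve_left (Nat.cast_ne_zero.2 (by omega))

end Syzygy

/-! ### General combinations of the partials -/

section Combinations

variable {F : Poly} {A : Matrix (Fin 3) (Fin 3) ℂ}

theorem combo_isHomogeneous {d : ℕ} (hF : F.IsHomogeneous d) (i : Fin 3) :
    (combo F A i).IsHomogeneous (d - 1) :=
  IsHomogeneous.sum _ _ _ fun j _ => by
    rw [smul_eq_C_mul]
    exact (hF.pderiv (i := j)).C_mul _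

theorem combo_mem_span (i : Fin 3) :
    combo F A i ∈ Ideal.span (Set.range fun j => pderiv j F) :=
  Ideal.sum_mem _ fun j _ => by
    rw [smul_eq_C_mul]
    exact Ideal.mul_mem_left _ _ (Ideal.subset_span ⟨j, rfl⟩)

theorem eval_combo (v : Fin 3 → ℂ) (i : Fin 3) :
    eval v (combo F A i) = dotProduct (A i) fun j => eval v (pderiv j F) := by
  simp [combo, dotProduct, smul_eval]

theorem eval_pderiv_combo (v : Fin 3 → ℂ) (i : Fin 3) :
    (fun l => eval v (pderiv l (combo F A i))) = (hessian F v).mulVec (A i) := by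
  funext l
  simp [combo, Matrix.mulVec, dotProduct, smul_eval, hessian, mul_comm]

theorem hessian_mulVec_self {d : ℕ} (hF : F.IsHomogeneous d) {v : Fin 3 → ℂ}
    (hv : ∀ i, eval v (pderiv i F) = 0) : (hessian F v).mulVec v = 0 := by
  funext l
  have h := congrArg (fun f => eval v (pderiv l f)) hF.sum_X_mul_pderiv
  simp only [map_sum, Derivation.leibniz, smul_eq_mul, map_add, map_mul, hv, zero_mul,
    add_zero, map_nsmul, smul_zero, eval_X] at h
  simp only [Matrix.mulVec, dotProduct, hessian, Matrix.of_apply, Pi.zero_apply]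
  rw [← h]
  exact Finset.sum_congr rfl fun i _ => mul_comm _ _

theorem hessian_smul {d : ℕ} (hF : F.IsHomogeneous d) (v : Fin 3 → ℂ) (t : ℂ) :
    hessian F (t • v) = t ^ (d - 1 - 1) • hessian F v := by
  ext i j
  simp only [hessian, Matrix.of_apply, Matrix.smul_apply, smul_eq_mul]
  exact eval_smul_of_isHomogeneous hF.pderiv.pderiv v t

/-- If the Hessian has rank two at a singular point, its kernel is spanned by the point. -/
theorem hessian_kernel {d : ℕ} (hF : F.IsHomogeneous d) {v : Fin 3 → ℂ} (hv : v ≠ 0)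
    (hsing : ∀ i, eval v (pderiv i F) = 0) (hrank : (hessian F v).rank = 2) (w : Fin 3 → ℂ)
    (hw : (hessian F v).mulVec w = 0) : ∃ c : ℂ, w = c • v := by
  have h1 := LinearMap.finrank_range_add_finrank_ker (hessian F v).mulVecLin
  rw [show Module.finrank ℂ (hessian F v).mulVecLin.range = 2 from hrank,
    Module.finrank_fintype_fun_eq_card, Fintype.card_fin] at h1
  have h2 : Module.finrank ℂ (hessian F v).mulVecLin.ker = 1 := by omega
  have hv' : v ∈ (hessian F v).mulVecLin.ker := hessian_mulVec_self hF hsing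
  obtain ⟨c, hc⟩ := (finrank_eq_one_iff_of_nonzero' (⟨v, hv'⟩ : (hessian F v).mulVecLin.ker)
    (fun h => hv (congrArg Subtype.val h))).1 h2 ⟨w, hw⟩
  exact ⟨c, (congrArg Subtype.val hc).symm⟩

theorem hessian_rank_eq_two {d : ℕ} (hF : F.IsHomogeneous d) (hd : d ≠ 0)
    (hnodal : ∀ p ∈ singularPoints F, IsNode F p) {v : Fin 3 → ℂ} (hv : v ≠ 0)
    (hsing : ∀ i, eval v (pderiv i F) = 0) :
    Projectivization.mk ℂ v hv ∈ singularPoints F ∧ (hessian F v).rank = 2 := by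
  have hmem : Projectivization.mk ℂ v hv ∈ singularPoints F :=
    ⟨(eval_rep_mk_eq_zero_iff hF hv).2 (eval_eq_zero_of_partials hF hd hsing),
      fun i => (eval_rep_mk_eq_zero_iff hF.pderiv hv).2 (hsing i)⟩
  refine ⟨hmem, ?_⟩
  obtain ⟨a, ha⟩ := Projectivization.exists_smul_eq_mk_rep ℂ v hv
  rw [← (hnodal _ hmem).2, ← ha, Units.smul_def, hessian_smul hF]
  exact (Matrix.rank_smul_of_mem_nonZeroDivisors _
    (mem_nonZeroDivisors_of_ne_zero (pow_ne_zero _ a.ne_zero))).symm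

theorem linearIndependent_rows_pair (hA : A.det ≠ 0) {i j : Fin 3} (hij : i ≠ j) :
    LinearIndependent ℂ ![A i, A j] := by
  have h := Matrix.linearIndependent_rows_of_det_ne_zero hA
  have heq : ![A i, A j] = (fun k => A k) ∘ ![i, j] := by
    funext k
    fin_cases k <;> rfl
  rw [heq]
  refine h.comp ![i, j] fun a b hab => ?_
  fin_cases a <;> fin_cases b <;> simp_all [hij.symm]

/-- The combinations of the partials with coefficient rows `A i`, `A j` meet transversally as soon
as the point `A i × A j` avoids the critical values of the gradient and the lines dual to the
nodes. -/
theorem combo_transversal {d : ℕ} (hF : F.IsHomogeneous d) (hd : 3 ≤ d)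
    (hnodal : ∀ p ∈ singularPoints F, IsNode F p) {Φ : Poly}
    (hΦ : ∀ v : Fin 3 → ℂ, (Matrix.of fun i j => eval v (pderiv j (pderiv i F))).det = 0 →
      eval (fun i => eval v (pderiv i F)) Φ = 0)
    (hA : A.det ≠ 0) {i j : Fin 3} (hij : i ≠ j)
    (hAΦ : eval (crossProduct (A i) (A j)) Φ ≠ 0)
    (hAp : ∀ p ∈ singularPoints F, dotProduct (crossProduct (A i) (A j)) p.rep ≠ 0) :
    Transversal (combo F A i) (combo F A j) := by
  intro v hv h1 h2
  rw [eval_pderiv_combo, eval_pderiv_combo, LinearIndependent.pair_iff]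
  intro s t hst
  rw [← Matrix.mulVec_smul, ← Matrix.mulVec_smul, ← Matrix.mulVec_add] at hst
  have hind := linearIndependent_rows_pair hA hij
  suffices h0 : s • A i + t • A j = 0 from LinearIndependent.pair_iff.1 hind s t h0
  rw [eval_combo] at h1 h2
  set x : Fin 3 → ℂ := fun l => eval v (pderiv l F) with hx
  set q := crossProduct (A i) (A j) with hq
  by_cases hsing : ∀ l, eval v (pderiv l F) = 0
  · obtain ⟨hmem, hrank⟩ := hessian_rank_eq_two hF (by omega) hnodal hv hsing
    obtain ⟨c, hc⟩ := hessian_kernel hF hv hsing hrank _ hst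
    -- At a node the combination is orthogonal to `q` and parallel to `v`, but `q · v ≠ 0`.
    have h3 : dotProduct q (s • A i + t • A j) = 0 := by
      rw [dotProduct_add, dotProduct_smul, dotProduct_smul, dotProduct_comm, hq, dot_self_cross,
        dotProduct_comm, dot_cross_self, smul_zero, smul_zero, add_zero]
    obtain ⟨a, ha⟩ := Projectivization.exists_smul_eq_mk_rep ℂ v hv
    have h4 := hAp _ hmem
    rw [← ha, Units.smul_def, dotProduct_smul, smul_eq_mul] at h4
    rw [hc, dotProduct_smul, smul_eq_mul] at h3
    rw [hc, (mul_eq_zero.1 h3).resolve_right (right_ne_zero_of_mul h4), zero_smul]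
  · have hx0 : x ≠ 0 := fun h => hsing fun l => congrFun h l
    have hq0 : q ≠ 0 := crossProduct_ne_zero_iff_linearIndependent.2 hind
    have hqx : crossProduct q x = 0 := by
      rw [hq, cross_cross_eq_smul_sub_smul, h1, h2, zero_smul, zero_smul, sub_self]
    obtain ⟨c, hc⟩ : ∃ c : ℂ, c • q = x := by
      by_contra! hne
      exact crossProduct_ne_zero_iff_linearIndependent.2
        ((LinearIndependent.pair_iff' hq0).2 hne) hqx
    have hc0 : c ≠ 0 := by
      rintro rfl
      exact hx0 (by rw [← hc, zero_smul])
    -- Scaling `v` by `t` makes the gradient equal to `q`, which is not a critical value.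
    obtain ⟨t, ht⟩ := IsAlgClosed.exists_pow_nat_eq c⁻¹ (n := d - 1) (by omega)
    have hdet : (hessian F v).det ≠ 0 := by
      intro h0
      apply hAΦ
      have h5 : (fun l => eval (t • v) (pderiv l F)) = q := by
        funext l
        rw [eval_smul_of_isHomogeneous hF.pderiv, ht]
        have := congrFun hc l
        simp only [Pi.smul_apply, smul_eq_mul, hx] at this
        rw [← this, inv_mul_cancel_left₀ hc0]
      rw [← h5]
      apply hΦ
      have h6 : (Matrix.of fun i j => eval (t • v) (pderiv j (pderiv i F))) =
          (hessian F (t • v)).transpose := rfl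
      rw [h6, Matrix.det_transpose, hessian_smul hF, Matrix.det_smul, h0, mul_zero]
    exact Matrix.eq_zero_of_mulVec_eq_zero hdet hst

/-- For a general matrix, the pairwise cross products of the rows avoid given proper algebraic
subsets. -/
theorem forGeneralGL_cross {Φ : Poly} (hΦ : Φ ≠ 0) {S : Set P2} (hS : S.Finite) :
    ForGeneralGL fun A => ∀ i j : Fin 3, i ≠ j → eval (crossProduct (A i) (A j)) Φ ≠ 0 ∧
      ∀ p ∈ S, dotProduct (crossProduct (A i) (A j)) p.rep ≠ 0 := by
  classical
  set Ψ : Poly := Φ * ∏ p ∈ hS.toFinset, ∑ l, C (p.rep l) * X l with hΨ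
  have hΨ0 : Ψ ≠ 0 := by
    refine mul_ne_zero hΦ (Finset.prod_ne_zero_iff.2 fun p _ h0 => p.rep_nonzero ?_)
    funext l
    have := congrArg (eval (Pi.single l 1)) h0
    simpa [Pi.single_apply] using this
  obtain ⟨w, hw⟩ := exists_eval_ne_zero (mul_ne_zero hΨ0 (X_ne_zero (R := ℂ) (0 : Fin 3)))
  rw [map_mul, eval_X] at hw
  have hw0 := right_ne_zero_of_mul hw
  have hwΨ := left_ne_zero_of_mul hw
  -- Two vectors orthogonal to `w`, scaled so that their product is `w`; the factor `X 0` above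
  -- ensured `w 0 ≠ 0`.
  have hcross : crossProduct ![-(w 1 / w 0), 1, 0] ![-w 2, 0, w 0] = w := by
    rw [cross_apply]
    funext l
    fin_cases l <;> simp [hw0]
  let row (i : Fin 3) : Fin 3 → MvPolynomial (Fin 3 × Fin 3) ℂ := fun l => X (i, l)
  let P (i j : Fin 3) : MvPolynomial (Fin 3 × Fin 3) ℂ := aeval (crossProduct (row i) (row j)) Ψ
  have hP (A : Matrix (Fin 3) (Fin 3) ℂ) (i j : Fin 3) :
      eval (fun ij => A ij.1 ij.2) (P i j) = eval (crossProduct (A i) (A j)) Ψ := by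
    have h1 : (fun l => eval (fun ij : Fin 3 × Fin 3 => A ij.1 ij.2)
        (crossProduct (row i) (row j) l)) = crossProduct (A i) (A j) := by
      rw [cross_apply, cross_apply]
      funext l
      fin_cases l <;> simp [row]
    rw [← h1]
    simp only [P]
    generalize Ψ = Θ
    induction Θ using MvPolynomial.induction_on with
    | C a => simp
    | add p q hp hq => simp only [map_add, hp, hq]
    | mul_X p i hp => simp only [map_mul, hp, eval_X, aeval_X]
  refine ⟨∏ ij ∈ Finset.univ.offDiag, P ij.1 ij.2, ?_, fun A _ hA i j hij => ?_⟩
  · rw [Finset.prod_ne_zero_iff]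
    rintro ⟨i, j⟩ hij h0
    have hij' : i ≠ j := (Finset.mem_offDiag.1 hij).2.2
    -- This matrix only witnesses that `P i j` is a nonzero polynomial, so it need not be
    -- invertible.
    have h := hP (Function.update (fun _ => ![-w 2, 0, w 0]) i ![-(w 1 / w 0), 1, 0]) i j
    rw [Function.update_self, Function.update_of_ne hij'.symm, hcross] at h
    apply hwΨ
    rw [← h]
    simp only at h0
    rw [h0, map_zero]
  · rw [map_prod, Finset.prod_ne_zero_iff] at hA
    have h := hA (i, j) (by simp [hij])
    rw [hP, hΨ, map_mul, map_prod] at h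
    refine ⟨left_ne_zero_of_mul h, fun p hp => ?_⟩
    have h2 := Finset.prod_ne_zero_iff.1 (right_ne_zero_of_mul h) p (hS.mem_toFinset.2 hp)
    rw [dotProduct_comm]
    simpa [dotProduct] using h2

end Combinations

/-! ### Interpolation points and linkage -/

section LinearAlgebra

/-- From a family of functionals with trivial common kernel one can choose a subfamily of
coordinates. -/
theorem exists_evaluation_basis {V ι : Type} [AddCommGroup V] [Module ℂ V]
    [FiniteDimensional ℂ V] [Finite ι] (φ : ι → Module.Dual ℂ V)
    (h : ∀ f, (∀ i, φ i f = 0) → f = 0) :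
    ∃ (κ : Type) (_ : Fintype κ) (a : κ → ι), Function.Injective a ∧
      Fintype.card κ = Module.finrank ℂ V ∧ (∀ f, (∀ k, φ (a k) f = 0) → f = 0) ∧
        ∀ y : κ → ℂ, ∃ f, ∀ k, φ (a k) f = y k := by
  -- A maximal independent subfamily still has trivial common kernel, so evaluation along it is
  -- injective between spaces of equal dimension.
  obtain ⟨κ, a, ha, hspan, hli⟩ := exists_linearIndependent' ℂ φ
  have : Finite κ := Finite.of_injective a ha
  let _ : Fintype κ := Fintype.ofFinite κ
  have hinj (f : V) (hf : ∀ k, φ (a k) f = 0) : f = 0 := by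
    apply h
    intro i
    have hi : φ i ∈ Submodule.span ℂ (Set.range (φ ∘ a)) := by
      rw [hspan]; exact Submodule.subset_span ⟨i, rfl⟩
    have hle : Submodule.span ℂ (Set.range (φ ∘ a)) ≤ (Module.Dual.eval ℂ V f).ker := by
      rw [Submodule.span_le]
      rintro _ ⟨k, rfl⟩
      exact hf k
    exact hle hi
  let ev : V →ₗ[ℂ] (κ → ℂ) := LinearMap.pi fun k => φ (a k)
  have hev : Function.Injective ev := by
    rw [← LinearMap.ker_eq_bot, LinearMap.ker_eq_bot']
    exact fun f hf => hinj f fun k => congrFun hf k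
  have h1 := hli.fintype_card_le_finrank
  rw [Subspace.dual_finrank_eq] at h1
  have h2 := LinearMap.finrank_le_finrank_of_injective hev
  rw [Module.finrank_fintype_fun_eq_card] at h2
  have hcard := le_antisymm h1 h2
  refine ⟨κ, inferInstance, a, ha, hcard, hinj, fun y => ?_⟩
  have hsurj := (LinearMap.injective_iff_surjective_of_finrank_eq_finrank (f := ev)
    (by rw [Module.finrank_fintype_fun_eq_card, hcard])).1 hev
  obtain ⟨f, hf⟩ := hsurj y
  exact ⟨f, fun k => congrFun hf k⟩

end LinearAlgebra

theorem eval_rep_of_mem_pointsIdeal {S : Set P2} {f : Poly} (hf : f ∈ pointsIdeal S) {p : P2}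
    (hp : p ∈ S) : eval p.rep f = 0 := by
  have := hf p.rep ⟨p.rep_nonzero, by rwa [p.mk_rep]⟩
  simpa [aeval_eq_eval] using this

theorem mem_pointsIdeal_iff {S : Set P2} {f : Poly} {k : ℕ} (hf : f.IsHomogeneous k) :
    f ∈ pointsIdeal S ↔ ∀ p ∈ S, eval p.rep f = 0 := by
  refine ⟨fun h p hp => eval_rep_of_mem_pointsIdeal h hp, ?_⟩
  rintro h v ⟨hv, hvS⟩
  simpa [aeval_eq_eval] using (eval_rep_mk_eq_zero_iff hf hv).1 (h _ hvS)

theorem h0_eq_zero {S : Set P2} {k : ℕ}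
    (h : ∀ f : Poly, f.IsHomogeneous k → (∀ p ∈ S, eval p.rep f = 0) → f = 0) : h0 S k = 0 := by
  rw [h0, Submodule.rank_eq_zero, eq_bot_iff]
  rintro f ⟨hf, hfS⟩
  exact h f hf fun p hp => eval_rep_of_mem_pointsIdeal hfS hp

/-- Linkage of point sets in the intersection of two transversal curves of degree `m + 2`: if the
complement of `Δ` lies on no curve of degree `m`, it splits into `Z` and `Y` as required. -/
theorem Transversal.exists_linked_decomposition {G H : Poly} {m n : ℕ} (h : Transversal G H)
    (hG : G.IsHomogeneous (m + 2)) (hH : H.IsHomogeneous (m + 2)) (hG0 : G ≠ 0) (hH0 : H ≠ 0)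
    {Δ : Set P2} (hΔ : Δ ⊆ zeroSet G ∩ zeroSet H) (hn : Δ.encard = (n : ℕ∞))
    (hS : ∀ Q : Poly, Q.IsHomogeneous m →
      (∀ p ∈ (zeroSet G ∩ zeroSet H) \ Δ, eval p.rep Q = 0) → Q = 0) :
    ∃ S : Set P2, (InterEqReduced G H (Δ ∪ S) ∧
      S.encard = (((m + 2) ^ 2 - n : ℕ) : ℕ∞) ∧ Disjoint S Δ) ∧
      ∃ Z Y : Set P2, S = Z ∪ Y ∧ Disjoint Z Y ∧
        Z.encard = (((m + 3).choose 2 - n : ℕ) : ℕ∞) ∧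
        Y.encard = (((m + 2).choose 2 : ℕ) : ℕ∞) ∧
        h0 (Z ∪ Δ) (m + 1) = 0 ∧ h0 Y m = 0 := by
  classical
  set Γ := zeroSet G ∩ zeroSet H with hΓ
  have hfin : Γ.Finite := finite_zeroSet_inter hG hH hG0 hH0 h.isRelPrime
  have hΓc : Γ.ncard = (m + 2) ^ 2 := by
    rw [Set.ncard, h.encard_inter hG hH hG0 hH0, ENat.toNat_natCast]
  have hΔc : Δ.ncard = n := by rw [Set.ncard, hn, ENat.toNat_natCast]
  have hSfin : (Γ \ Δ).Finite := hfin.subset Set.sdiff_subset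
  have hSc : (Γ \ Δ).ncard = (m + 2) ^ 2 - n := by
    rw [Set.ncard_sdiff hΔ (hfin.subset hΔ), hΓc, hΔc]
  have hunion : Δ ∪ (Γ \ Δ) = Γ := Set.union_sdiff_cancel hΔ
  have : Finite ↥(Γ \ Δ) := hSfin
  obtain ⟨κ, _, a, ha, hκ, hinj, hsurj⟩ := exists_evaluation_basis
    (V := homogeneousSubmodule (Fin 3) ℂ m) (ι := ↥(Γ \ Δ))
    (fun p => (aeval (R := ℂ) p.1.rep).toLinearMap.domRestrict _)
    (fun f hf => Subtype.ext (hS f.1 f.2 fun p hp => by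
      simpa [aeval_eq_eval] using hf ⟨p, hp⟩))
  rw [finrank_homogeneousSubmodule] at hκ
  set Y : Set P2 := Set.range fun k => (a k).1 with hY
  have hYS : Y ⊆ Γ \ Δ := by rintro _ ⟨k, rfl⟩; exact (a k).2
  have hYc : Y.ncard = (m + 2).choose 2 := by
    rw [hY, ← Set.image_univ, Set.ncard_image_of_injective (f := fun k => (a k).1) Set.univ
      (Subtype.val_injective.comp ha),
      Set.ncard_univ, Nat.card_eq_fintype_card, hκ]
  have hchoose : (m + 2) ^ 2 = (m + 3).choose 2 + (m + 2).choose 2 := by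
    have h1 := Nat.add_one_mul_choose_eq (m + 1) 1
    have h2 := Nat.add_one_mul_choose_eq (m + 2) 1
    simp only [Nat.choose_one_right] at h1 h2
    nlinarith
  have hZc : ((Γ \ Δ) \ Y).ncard = (m + 3).choose 2 - n := by
    rw [Set.ncard_sdiff hYS (hSfin.subset hYS), hSc, hYc]
    omega
  have henc {s : Set P2} {c : ℕ} (hs : s.Finite) (hc : s.ncard = c) : s.encard = (c : ℕ∞) := by
    rw [← hc, hs.cast_ncard_eq]
  refine ⟨Γ \ Δ, ⟨⟨hunion.symm, 0, fun k _ f hf => ?_⟩, henc hSfin hSc, Set.disjoint_sdiff_left⟩,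
    (Γ \ Δ) \ Y, Y, (Set.sdiff_union_of_subset hYS).symm, Set.disjoint_sdiff_left,
    henc (hSfin.subset Set.sdiff_subset) hZc, henc (hSfin.subset hYS) hYc, ?_, ?_⟩
  · rw [hunion, mem_pointsIdeal_iff hf]
    constructor
    · intro hmem p hp
      obtain ⟨a, b, rfl⟩ := Ideal.mem_span_pair.1 hmem
      rw [map_add, map_mul, map_mul, show eval p.rep G = 0 from hp.1,
        show eval p.rep H = 0 from hp.2]
      ring
    · exact fun hv => h.mem_span_pair hG hH hG0 hH0 hf hv
  · refine h0_eq_zero fun f hf hfv => ?_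
    -- Multiply `f` by the form `g` of degree `m` that is one at the `k`th point of `Y` and zero at
    -- the others. The product has degree `2 * m + 1` and vanishes on the intersection off that
    -- point, as Cayley–Bacharach requires.
    have hfY (k : κ) : eval (a k).1.rep f = 0 := by
      obtain ⟨g, hg⟩ := hsurj (Pi.single k 1)
      have hg' (k') : eval (a k').1.rep g.1 = (Pi.single k 1 : κ → ℂ) k' := by
        rw [← hg k']
        simp [aeval_eq_eval]
      have hcb := h.cayley_bacharach hG hH hG0 hH0 (f := f * g.1) (p := (a k).1) ?_
        (a k).2.1 ?_
      · rw [map_mul, hg', Pi.single_eq_same, mul_one] at hcb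
        exact hcb
      · convert hf.mul ((mem_homogeneousSubmodule _ _).1 g.2) using 1
        ring
      · intro q hq hqk
        rw [map_mul]
        by_cases hqY : q ∈ Y
        · obtain ⟨k', rfl⟩ := hqY
          rw [hg', Pi.single_eq_of_ne (fun h => hqk (by rw [h])), mul_zero]
        · rw [hfv q ?_, zero_mul]
          by_cases hqΔ : q ∈ Δ
          · exact Or.inr hqΔ
          · exact Or.inl ⟨⟨hq, hqΔ⟩, hqY⟩
    refine eq_zero_of_mem_span_pair_of_lt hG hH hf (by omega)
      (h.mem_span_pair hG hH hG0 hH0 hf fun q hq => ?_)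
    by_cases hqY : q ∈ Y
    · obtain ⟨k, rfl⟩ := hqY
      exact hfY k
    · by_cases hqΔ : q ∈ Δ
      · exact hfv q (Or.inr hqΔ)
      · exact hfv q (Or.inl ⟨⟨hq, hqΔ⟩, hqY⟩)
  · refine h0_eq_zero fun f hf hfv => ?_
    have := hinj ⟨f, hf⟩ fun k => by simpa [aeval_eq_eval] using hfv _ ⟨k, rfl⟩
    exact congrArg Subtype.val this

/-! ### No form of degree `m` through the residual points -/

section Nodal

variable {F : Poly} {m : ℕ} {A : Matrix (Fin 3) (Fin 3) ℂ}

/-- A syzygy of degree `m` between the partials of an irreducible nodal form of degree `m + 3`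
vanishes, as soon as two combinations of the partials meet transversally. -/
theorem syzygy_eq_zero_of_transversal (hF : F.IsHomogeneous (m + 3)) (hirr : Irreducible F)
    (hnodal : ∀ p ∈ singularPoints F, IsNode F p) {i j : Fin 3}
    (htr : Transversal (combo F A i) (combo F A j)) {δ : Fin 3 → Poly}
    (hδm : ∀ i, (δ i).IsHomogeneous m) (hδ : ∑ i, δ i * pderiv i F = 0) : δ = 0 := by
  refine syzygy_eq_zero hF hirr (fun v hv hs => hessian_kernel hF hv hs
    (hessian_rank_eq_two hF (by omega) hnodal hv hs).2) (fun v hv hs h0 => ?_)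
    (fun v hv hs k Q hQ hQv => ?_) hδm hδ
  · have := (hessian_rank_eq_two hF (by omega) hnodal hv hs).2
    rw [h0, Matrix.rank_zero] at this
    omega
  · have hc (i : Fin 3) : eval v (combo F A i) = 0 := by
      rw [eval_combo]
      simp [hs, dotProduct]
    obtain ⟨r, hr, hr'⟩ := exists_local_multiplier (combo_isHomogeneous hF i)
      (combo_isHomogeneous hF j) hQ hv (hc i) (hc j) hQv (htr v hv (hc i) (hc j))
    -- Two transversal combinations already generate the ideal of the node locally, hence so do the
    -- partials.
    refine ⟨r, hr, Ideal.span_le.2 ?_ hr'⟩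
    rintro _ (rfl | rfl)
    exacts [combo_mem_span i, combo_mem_span j]

/-- A constant relation times `X 0 ^ m` is a syzygy of degree `m`. -/
theorem linearIndependent_partials (hF : F.IsHomogeneous (m + 3)) (hirr : Irreducible F)
    (hnodal : ∀ p ∈ singularPoints F, IsNode F p) {i j : Fin 3}
    (htr : Transversal (combo F A i) (combo F A j)) :
    LinearIndependent ℂ fun i => pderiv i F := by
  rw [Fintype.linearIndependent_iff]
  intro c hc l
  have h := syzygy_eq_zero_of_transversal hF hirr hnodal htr
    (δ := fun i => C (c i) * X 0 ^ m) (fun i => isHomogeneous_C_mul_X_pow _ _ _) (by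
      have : ∑ i, C (c i) * X 0 ^ m * pderiv i F = X 0 ^ m * ∑ i, c i • pderiv i F := by
        rw [Finset.mul_sum]
        refine Finset.sum_congr rfl fun i _ => ?_
        rw [smul_eq_C_mul]
        ring
      rw [this, hc, mul_zero])
  have h1 : C (c l) * X 0 ^ m = (0 : Poly) := congrFun h l
  have h2 := (mul_eq_zero.1 h1).resolve_right (pow_ne_zero _ (X_ne_zero _))
  exact C_eq_zero.1 h2

theorem combo_linearIndependent (hA : A.det ≠ 0) (hF : LinearIndependent ℂ fun i => pderiv i F) :
    LinearIndependent ℂ (combo F A) := by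
  rw [Fintype.linearIndependent_iff] at hF ⊢
  intro c hc
  have h : ∑ j, (Matrix.vecMul c A j) • pderiv j F = 0 := by
    rw [← hc]
    simp only [combo, Matrix.vecMul, dotProduct, Finset.sum_smul, Finset.smul_sum, smul_smul]
    exact Finset.sum_comm
  have h0 := Matrix.eq_zero_of_vecMul_eq_zero hA (funext (hF _ h))
  exact congrFun h0

theorem span_combo (hA : A.det ≠ 0) (hF : LinearIndependent ℂ fun i => pderiv i F) :
    Submodule.span ℂ (Set.range (combo F A)) =
      Submodule.span ℂ (Set.range fun i => pderiv i F) := by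
  have : FiniteDimensional ℂ (Submodule.span ℂ (Set.range fun i => pderiv i F)) :=
    FiniteDimensional.span_of_finite ℂ (Set.finite_range _)
  apply Submodule.eq_of_le_of_finrank_eq
  · rw [Submodule.span_le]
    rintro _ ⟨i, rfl⟩
    exact Submodule.sum_mem _ fun j _ => Submodule.smul_mem _ _ (Submodule.subset_span ⟨j, rfl⟩)
  · rw [finrank_span_eq_card (combo_linearIndependent hA hF), finrank_span_eq_card hF]

theorem sum_syzygy_combo (F a b Q : Poly) (A : Matrix (Fin 3) (Fin 3) ℂ) (i j l : Fin 3) :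
    ∑ k, (C (A i k) * a + C (A j k) * b - C ((Pi.single l 1 : Fin 3 → ℂ) k) * Q) * pderiv k F =
      a * combo F A i + b * combo F A j - Q * pderiv l F := by
  have h1 : ∑ k, C ((Pi.single l 1 : Fin 3 → ℂ) k) * pderiv k F = pderiv l F := by
    simp [Pi.single_apply]
  have h2 (i : Fin 3) : ∑ k, C (A i k) * pderiv k F = combo F A i := by
    simp [combo, smul_eq_C_mul]
  rw [← h2, ← h2, ← h1]
  simp only [Finset.mul_sum, ← Finset.sum_add_distrib, ← Finset.sum_sub_distrib]
  exact Finset.sum_congr rfl fun k _ => by ring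

/-- Pairing the vector relation with `q` leaves only the term `q l * Q`. -/
theorem eq_zero_of_orthogonal {a b Q : Poly} {x y q : Fin 3 → ℂ} {l : Fin 3} (hl : q l ≠ 0)
    (hx : dotProduct x q = 0) (hy : dotProduct y q = 0)
    (h : ∀ k, C (x k) * a + C (y k) * b - C ((Pi.single l 1 : Fin 3 → ℂ) k) * Q = 0) :
    Q = 0 := by
  have hs : dotProduct (Pi.single l 1) q = q l := by simp
  have hsum : C (dotProduct x q) * a + C (dotProduct y q) * b
      - C (dotProduct (Pi.single l 1) q) * Q = 0 := by
    calc _ = ∑ k, C (q k) *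
          (C (x k) * a + C (y k) * b - C ((Pi.single l 1 : Fin 3 → ℂ) k) * Q) := by
          simp only [dotProduct, map_sum, map_mul, Finset.sum_mul, ← Finset.sum_add_distrib,
            ← Finset.sum_sub_distrib]
          exact Finset.sum_congr rfl fun k _ => by ring
      _ = 0 := Finset.sum_eq_zero fun k _ => by rw [h k, mul_zero]
  rw [hx, hy, hs, C_0, zero_mul, zero_mul, add_zero, zero_sub, neg_eq_zero] at hsum
  exact (mul_eq_zero.1 hsum).resolve_left fun h => hl (C_eq_zero.1 h)

/-- No form of degree `m` passes through the intersection points of two general combinations of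
the partials other than the nodes. -/
theorem eq_zero_of_vanishing_off_nodes (hF : F.IsHomogeneous (m + 3)) (hirr : Irreducible F)
    (hnodal : ∀ p ∈ singularPoints F, IsNode F p) (hA : A.det ≠ 0) {i j : Fin 3} (hij : i ≠ j)
    (htr : Transversal (combo F A i) (combo F A j)) (hi : combo F A i ≠ 0) (hj : combo F A j ≠ 0)
    {Q : Poly} (hQ : Q.IsHomogeneous m)
    (hQv : ∀ p ∈ (zeroSet (combo F A i) ∩ zeroSet (combo F A j)) \ singularPoints F,
      eval p.rep Q = 0) : Q = 0 := by
  have hci (i : Fin 3) : (combo F A i).IsHomogeneous (m + 2) := combo_isHomogeneous hF i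
  -- The index `l` is one where `A i × A j` is nonzero, so the `l`th basis vector is not in the span
  -- of the two rows.
  obtain ⟨l, hl⟩ := Function.ne_iff.1 (crossProduct_ne_zero_iff_linearIndependent.2
    (linearIndependent_rows_pair hA hij))
  have hpl : (pderiv l F).IsHomogeneous (m + 2) := hF.pderiv
  have hQl : (Q * pderiv l F).IsHomogeneous (m + 2 + m) := by
    rw [add_comm]
    exact hQ.mul hpl
  obtain ⟨a, b, ha, hb, hab⟩ := exists_homogeneous_of_mem_span_pair (hci i) (hci j) hQl
    (htr.mem_span_pair (hci i) (hci j) hi hj hQl fun p hp => by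
      rw [map_mul]
      by_cases hs : p ∈ singularPoints F
      · rw [hs.2 l, mul_zero]
      · rw [hQv p ⟨hp, hs⟩, zero_mul])
  have hδ := syzygy_eq_zero_of_transversal hF hirr hnodal htr
    (fun k => ((ha.C_mul (A i k)).add (hb.C_mul (A j k))).sub
      (hQ.C_mul ((Pi.single l 1 : Fin 3 → ℂ) k)))
    (by rw [sum_syzygy_combo, hab, sub_self])
  exact eq_zero_of_orthogonal hl (dot_self_cross _ _) (dot_cross_self _ _) (congrFun hδ)

end Nodal

end NodalPlaneCurve

/-! ### The main theorem -/

open NodalPlaneCurve in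
theorem lemmaL (d n : ℕ) (hd : 3 ≤ d) (hn : n ≤ (d - 1).choose 2 - 1)
    (F : Poly) (hF : F.IsHomogeneous d) (hirr : Irreducible F)
    (hnodal : ∀ p ∈ singularPoints F, IsNode F p)
    (hcard : (singularPoints F).encard = (n : ℕ∞)) :
    ForGeneralGL fun A =>
      (LinearIndependent ℂ (combo F A) ∧
        Submodule.span ℂ (Set.range (combo F A)) =
          Submodule.span ℂ (Set.range fun i => pderiv i F)) ∧
      ∀ i j : Fin 3, i ≠ j →
        ∃ S : Set P2,
          (InterEqReduced (combo F A i) (combo F A j) (singularPoints F ∪ S) ∧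
            S.encard = (((d - 1) ^ 2 - n : ℕ) : ℕ∞) ∧
            Disjoint S (singularPoints F)) ∧
          ∃ Z Y : Set P2,
            S = Z ∪ Y ∧ Disjoint Z Y ∧
            Z.encard = ((d.choose 2 - n : ℕ) : ℕ∞) ∧
            Y.encard = (((d - 1).choose 2 : ℕ) : ℕ∞) ∧
            h0 (Z ∪ singularPoints F) (d - 2) = 0 ∧
            h0 Y (d - 3) = 0 := by
  obtain ⟨m, rfl⟩ := Nat.exists_eq_add_of_le' hd
  obtain ⟨Φ, hΦ0, hΦ⟩ := exists_vanishing_on_critical_values fun i => pderiv i F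
  obtain ⟨P, hP0, hP⟩ := forGeneralGL_cross hΦ0 (Set.finite_of_encard_eq_coe hcard)
  refine ⟨P, hP0, fun A hA hPA => ?_⟩
  have htr (i j : Fin 3) (hij : i ≠ j) : Transversal (combo F A i) (combo F A j) :=
    combo_transversal hF hd hnodal hΦ hA hij (hP A hA hPA i j hij).1 (hP A hA hPA i j hij).2
  have hli := linearIndependent_partials hF hirr hnodal (htr 0 1 (by decide))
  have hli' := combo_linearIndependent hA hli
  refine ⟨⟨hli', span_combo hA hli⟩, fun i j hij => ?_⟩
  have hΔ : singularPoints F ⊆ zeroSet (combo F A i) ∩ zeroSet (combo F A j) := by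
    intro p hp
    have hc (i : Fin 3) : eval p.rep (combo F A i) = 0 := by
      rw [eval_combo]
      simp [hp.2, dotProduct]
    exact ⟨hc i, hc j⟩
  exact (htr i j hij).exists_linked_decomposition (combo_isHomogeneous hF i)
    (combo_isHomogeneous hF j) (hli'.ne_zero i) (hli'.ne_zero j) hΔ hcard
    fun Q hQ hQv => eq_zero_of_vanishing_off_nodes hF hirr hnodal hA hij (htr i j hij)
      (hli'.ne_zero i) (hli'.ne_zero j) hQ hQv
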